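/- Let $N,n\ge 0$ be integers and let $\lambda=(\lambda_1,\dots,\lambda_N)\in\mathbb Z_{\ge0}^N$ with $\lambda_1+\dots+\lambda_N=n$. **Current algebra and Bethe algebra.** Let $\mathfrak{gl}_N[t]=\mathfrak{gl}_N\otimes\mathbb C[t]$ with the pointwise commutator, with basis $e_{ij}\otimes t^r$, and put $e_{ij}(u)=\sum_{s\ge0}(e_{ij}\otimes t^s)u^{-s-1}$. For $K=(K_1,\dots,K_N)\in\mathbb C^N$ let $\mathcal D^K=\mathrm{rdet}\,\bigl(\delta_{ij}(\partial_u-K_i)-e_{ji}(u)\bigr)_{i,j=1}^N$, where $\mathrm{rdet}\,A=\sum_{\sigma\in S_N}(-1)^\sigma a_{1\sigma(1)}\cdots a_{N\sigma(N)}$, and write $\mathcal D^K=\partial_u^N+\sum_{i=1}^N\sum_{j\ge0}B^K_{ij}u^{-j}\partial_u^{N-i}$ with $B^K_{ij}\in U(\mathfrak{gl}_N[t])$. The limiting Bethe algebra $\mathcal B^\infty$ is the unital subalgebra of $U(\mathfrak{gl}_N[t])$ generated by the leading terms of all $B^K_{ij}$ as $K$ tends to infinity so that all $K_i\to\infty$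 and all $K_i/K_{i+1}\to\infty$ (the leading term of $B_{ij}^K$ is the nonzero element $c$ such that $B_{ij}^K=K_1^{a_1}\cdots K_N^{a_N}(c+o(1))$ for some exponents $a_1,\dots,a_N\ge 0$). **Modules.** Let $V=\mathbb C^N$ with standard basis $v_1,\dots,v_N$ and $\mathcal V=V^{\otimes n}\otimes\mathbb C[z_1,\dots,z_n]$, where $g\otimes t^r$ acts by $v_1\otimes\dots\otimes v_n\otimes p\mapsto\sum_{s=1}^n v_1\otimes\dots\otimes gv_s\otimes\dots\otimes v_n\otimes z_s^rp$. The group $S_n$ acts on $\mathcal V$ by permuting the tensor factors and the variables simultaneously; $\mathcal V^+$ and $\mathcal V^-$ are the subspaces of invariants and antiinvariants, and $\mathcal V^\pm_\lambda\subset\mathcal V^\pm$ are the subspaces on which $e_{ii}\otimes 1$ acts as $\lambda_i$ for every $i$. Put $D=\prod_{1\le i<j\le n}(z_j-z_i)$ and let $\frac1D\mathcal V^-_\lambda$ be the space of $V^{\otimes n}$-valued rational functions $\frac1Dx$, $x\in\mathcal V^-_\lambda$; an operator $b$ on $\mathcal V^-_\lambda$ acts on it by $b(\frac1Dx)=\frac1D(bx)$.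 For a $\mathcal B^\infty$-invariant subspace $L\subset\mathcal V$, let $\mathcal B^\infty(L)$ be the image of $\mathcal B^\infty$ in $\mathrm{End}(L)$. **Cohomology.** Let $\mathcal F_\lambda$ be the variety of flags $0=F_0\subset F_1\subset\dots\subset F_N=\mathbb C^n$ with $\dim F_i/F_{i-1}=\lambda_i$, and let $H_\lambda=H^*_{GL_n}(\mathcal F_\lambda,\mathbb C)$ be given by its presentation $$H_\lambda=\mathbb C[z_1,\dots,z_n;\ \gamma_{ij},\,1\le i\le N,\,1\le j\le\lambda_i]^{S_n\times S_{\lambda_1}\times\dots\times S_{\lambda_N}}\Big/\Bigl\langle\ \prod_{i=1}^N\prod_{j=1}^{\lambda_i}(1+u\gamma_{ij})=\prod_{s=1}^n(1+uz_s)\ \Bigr\rangle .$$ Here $S_n$ permutes the $z_s$, $S_{\lambda_i}$ permutes $\gamma_{i1},\dots,\gamma_{i\lambda_i}$, the ideal is generated by the coefficients of the powers of $u$ in the difference of the two sides, $\gamma_{i1},\dots,\gamma_{i\lambda_i}$ are the Chern roots of the bundle with fibre $F_i/F_{i-1}$, and $z_1,\dots,z_n$ are the Chern roots of the diagonal torus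 of $GL_n$. **The maps $i^\pm_\lambda$.** For a decomposition $I=(I_1,\dots,I_N)$ of $\{1,\dots,n\}$ into disjoint subsets with $|I_j|=\lambda_j$, let $v_I=v_{i_1}\otimes\dots\otimes v_{i_n}$, where $k\in I_{i_k}$, let $z_{I_j}=\{z_a: a\in I_j\}$, and let $R_I=\prod_{i<j}\prod_{a\in I_i,\,b\in I_j}(z_b-z_a)$. Put $$i^+_\lambda[h]=\sum_I v_I\otimes h(z,z_{I_1},\dots,z_{I_N}),\qquad i^-_\lambda[h]=\sum_I v_I\otimes\frac{h(z,z_{I_1},\dots,z_{I_N})}{R_I}.$$ **Theorem.** The subspaces $\mathcal V^\pm_\lambda$ are $\mathcal B^\infty$-invariant, the restrictions of all $e_{ii}\otimes t^r$ to $\mathcal V^\pm_\lambda$ belong to $\mathcal B^\infty(\mathcal V^\pm_\lambda)$, and: (i) The assignments $e_{ii}\otimes t^r|_{\mathcal V^\pm_\lambda}\mapsto\bigl[\sum_{j=1}^{\lambda_i}\gamma_{ij}^r\bigr]$ ($1\le i\le N$, $r\ge0$) extend to unique algebra homomorphisms $\xi^\pm_\lambda:\mathcal B^\infty(\mathcal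 V^\pm_\lambda)\to H_\lambda$, and these are isomorphisms. (ii) The map $i^+_\lambda$ is a linear bijection of $H_\lambda$ onto $\mathcal V^+_\lambda$, and $i^+_\lambda(\xi^+_\lambda(b)\,h)=b\,i^+_\lambda(h)$ for all $b\in\mathcal B^\infty(\mathcal V^+_\lambda)$ and $h\in H_\lambda$. Thus $\xi^+_\lambda,i^+_\lambda$ identify the $\mathcal B^\infty(\mathcal V^+_\lambda)$-module $\mathcal V^+_\lambda$ with the regular representation of $H_\lambda$. (iii) The map $i^-_\lambda$ is a linear bijection of $H_\lambda$ onto $\frac1D\mathcal V^-_\lambda$, and $i^-_\lambda(\xi^-_\lambda(b)\,h)=b\,i^-_\lambda(h)$ for all $b\in\mathcal B^\infty(\mathcal V^-_\lambda)$ and $h\in H_\lambda$. Thus $\xi^-_\lambda,i^-_\lambda$ identify the $\mathcal B^\infty(\mathcal V^-_\lambda)$-module $\mathcal V^-_\lambda\cong\frac1D\mathcal V^-_\lambda$ with the regular representation of $H_\lambda$. -/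

import Mathlib

noncomputable section

namespace FlagBethe

attribute [local instance] LieRing.ofAssociativeRing

/-! ### The current algebra and its universal enveloping algebra -/

/-- The current algebra `gl_N[t]`: matrices of size `N` with entries in `ℂ[t]`, with the commutator
as Lie bracket. -/
abbrev Current (N : ℕ) : Type := Matrix (Fin N) (Fin N) (Polynomial ℂ)

/-- The universal enveloping algebra `U(gl_N[t])` over `ℂ`. -/
abbrev UCurrent (N : ℕ) : Type := UniversalEnvelopingAlgebra ℂ (Current N)

/-- The basis element `e_{ij} ⊗ t^r` of `gl_N[t]`. -/
def currentBasis {N : ℕ} (i j : Fin N) (r : ℕ) : Current N :=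
  Matrix.single i j (Polynomial.X ^ r)

/-- The element `e_{ij} ⊗ t^r` of `U(gl_N[t])`. -/
def uBasis {N : ℕ} (i j : Fin N) (r : ℕ) : UCurrent N :=
  UniversalEnvelopingAlgebra.ι ℂ (currentBasis i j r)

/-! ### The Bethe algebra and its limit -/

/-- Row determinant of a matrix with possibly noncommuting entries: the factors of each summand are
multiplied in the order of the rows. -/
def rdet {R : Type*} [Ring R] {N : ℕ} (A : Matrix (Fin N) (Fin N) R) : R :=
  ∑ σ : Equiv.Perm (Fin N),
    ((Equiv.Perm.sign σ : ℤˣ) : ℤ) • (List.ofFn fun i => A i (σ i)).prod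

/-- Formal power series in `u⁻¹` with coefficients in `U(gl_N[t])`; the coefficient of index `j`
is the coefficient of `u^{-j}`. -/
abbrev USeries (N : ℕ) : Type := PowerSeries (UCurrent N)

/-- The derivation `d/du` of formal power series in `u⁻¹`, so `u^{-j} ↦ -j u^{-j-1}`. -/
def uDeriv (N : ℕ) : USeries N →ₗ[ℂ] USeries N where
  toFun f := PowerSeries.mk fun m => -(((m - 1 : ℕ) : ℂ) • PowerSeries.coeff (m - 1) f)
  map_add' f g := by
    ext m
    simp only [PowerSeries.coeff_mk, map_add, smul_add, neg_add]
  map_smul' c f := by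
    ext m
    simp only [PowerSeries.coeff_mk, PowerSeries.coeff_smul, RingHom.id_apply, smul_neg]
    rw [smul_comm]

/-- Differential operators `∑ a_k ∂^k` in `u` whose coefficients are formal power series in `u⁻¹`
over `U(gl_N[t])`, in normal form (coefficients to the left of `∂`); the value at `k` is `a_k`. -/
abbrev DiffOp (N : ℕ) : Type := ℕ →₀ USeries N

/-- Composition on the left with `∂`: `∂ ∘ a ∂^k = a ∂^{k+1} + (da/du) ∂^k`. -/
def leftDer (N : ℕ) : Module.End ℂ (DiffOp N) :=
  Finsupp.lmapDomain (USeries N) ℂ Nat.succ + Finsupp.mapRange.linearMap (uDeriv N)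

/-- Composition on the left with the operator of multiplication by the series `b`:
`b ∘ a ∂^k = (b a) ∂^k`. -/
def leftMul {N : ℕ} (b : USeries N) : Module.End ℂ (DiffOp N) :=
  Finsupp.mapRange.linearMap (LinearMap.mulLeft ℂ b)

/-- The generating series `e_{ij}(u) = ∑_{s ≥ 0} (e_{ij} ⊗ t^s) u^{-s-1}`. -/
def genSeries {N : ℕ} (i j : Fin N) : USeries N :=
  PowerSeries.mk fun m => if m = 0 then 0 else uBasis i j (m - 1)

/-- The matrix with entry `δ_{ij} (∂ - K_i) - e_{ji}(u)` in row `i` and column `j`. A differential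
operator is represented by the operator of composition with it on the left. -/
def betheMatrix {N : ℕ} (K : Fin N → ℂ) :
    Matrix (Fin N) (Fin N) (Module.End ℂ (DiffOp N)) :=
  fun i j => (if i = j then leftDer N - K i • (1 : Module.End ℂ (DiffOp N)) else 0)
    - leftMul (genSeries j i)

/-- The universal differential operator `D^K`, the row determinant of the matrix above, in normal
form (a differential operator is recovered by composing it with the identity operator). -/
def universalOp {N : ℕ} (K : Fin N → ℂ) : DiffOp N :=
  rdet (betheMatrix K) (Finsupp.single 0 1)

/-- `B^K_{ij}`: the coefficient of `u^{-j}` in the coefficient of `∂^{N-i}` in `D^K`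
(used for `1 ≤ i ≤ N`). -/
def betheCoeff {N : ℕ} (K : Fin N → ℂ) (i j : ℕ) : UCurrent N :=
  PowerSeries.coeff j (universalOp K (N - i))

/-- The regime in which all coordinates of `K` tend to infinity and so do all ratios
`K_i / K_{i+1}`. -/
def zone (N : ℕ) : Filter (Fin N → ℂ) :=
  (⨅ i : Fin N, Filter.comap (fun K => K i) (Bornology.cobounded ℂ)) ⊓
  (⨅ i : Fin N, ⨅ j : Fin N, ⨅ _ : (i : ℕ) + 1 = (j : ℕ),
    Filter.comap (fun K => K i / K j) (Bornology.cobounded ℂ))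

/-- `c` is the leading term of the function `F` (a polynomial in `K` with coefficients in
`U(gl_N[t])` in our use): for some monomial `K^a` one has `F(K) = K^a (c + o(1))` with `c ≠ 0`.
The values of a polynomial `F` lie in a finite-dimensional space, where convergence can be tested
on linear functionals. -/
def IsLeadingTerm {N : ℕ} (F : (Fin N → ℂ) → UCurrent N) (c : UCurrent N) : Prop :=
  c ≠ 0 ∧ ∃ a : Fin N → ℕ, ∀ φ : UCurrent N →ₗ[ℂ] ℂ,
    Filter.Tendsto (fun K => φ (F K) / ∏ i, K i ^ a i) (zone N) (nhds (φ c))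

/-- The limiting Bethe algebra `B^∞`: the unital subalgebra of `U(gl_N[t])` generated by the leading
terms of the elements `B^K_{ij}`, `1 ≤ i ≤ N`, `j ≥ 0`. -/
def betheInf (N : ℕ) : Subalgebra ℂ (UCurrent N) :=
  Algebra.adjoin ℂ {c | ∃ i j : ℕ, 1 ≤ i ∧ i ≤ N ∧ IsLeadingTerm (fun K => betheCoeff K i j) c}

/-! ### The modules `V⁺` and `V⁻` -/

/-- The space `(ℂ^N)^{⊗n} ⊗ ℂ[z_1, …, z_n]`, in coordinates with respect to the basis
`v_{w_1} ⊗ ⋯ ⊗ v_{w_n}`: the function `f` stands for `∑_w v_{w_1} ⊗ ⋯ ⊗ v_{w_n} ⊗ f(w)`. -/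
abbrev PolySpace (N n : ℕ) : Type := (Fin n → Fin N) → MvPolynomial (Fin n) ℂ

/-- The action of `g ⊗ p(t)` in the `s`-th factor: `g` acts on the `s`-th tensor factor, and the
polynomial is multiplied by `p(z_s)`. -/
def slot {N n : ℕ} (s : Fin n) : Current N →ₗ[ℂ] Module.End ℂ (PolySpace N n) where
  toFun A :=
    { toFun := fun f w => ∑ k : Fin N,
        Polynomial.aeval (MvPolynomial.X s) (A (w s) k) * f (Function.update w s k)
      map_add' := fun f g => by
        ext1 w
        simp [mul_add, Finset.sum_add_distrib]
      map_smul' := fun c f => by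
        ext1 w
        simp [Finset.smul_sum] }
  map_add' A B := by
    refine LinearMap.ext fun f => funext fun w => ?_
    simp [add_mul, Finset.sum_add_distrib]
  map_smul' c A := by
    refine LinearMap.ext fun f => funext fun w => ?_
    simp [Finset.smul_sum]

theorem slot_apply {N n : ℕ} (s : Fin n) (A : Current N) (f : PolySpace N n)
    (w : Fin n → Fin N) :
    slot s A f w = ∑ k : Fin N,
      Polynomial.aeval (MvPolynomial.X s) (A (w s) k) * f (Function.update w s k) := rfl

theorem slot_mul {N n : ℕ} (s : Fin n) (A B : Current N) :
    slot s (A * B) = slot s A * slot s B := by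
  refine LinearMap.ext fun f => funext fun w => ?_
  simp only [Module.End.mul_apply, slot_apply, Matrix.mul_apply, map_sum, map_mul,
    Function.update_self, Function.update_idem, Finset.sum_mul, Finset.mul_sum]
  rw [Finset.sum_comm]
  simp only [mul_assoc]

theorem slot_comm {N n : ℕ} {s s' : Fin n} (h : s ≠ s') (A B : Current N) :
    slot s A * slot s' B = slot s' B * slot s A := by
  refine LinearMap.ext fun f => funext fun w => ?_
  simp only [Module.End.mul_apply, slot_apply, Finset.mul_sum,
    Function.update_of_ne h, Function.update_of_ne h.symm]
  rw [Finset.sum_comm]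
  refine Finset.sum_congr rfl fun k _ => Finset.sum_congr rfl fun l _ => ?_
  rw [Function.update_comm h]
  ring

/-- The Lie algebra action of `gl_N[t]` on `(ℂ^N)^{⊗n} ⊗ ℂ[z_1, …, z_n]`:
`g ⊗ t^r` sends `v_1 ⊗ ⋯ ⊗ v_n ⊗ p` to `∑_s v_1 ⊗ ⋯ ⊗ g v_s ⊗ ⋯ ⊗ v_n ⊗ z_s^r p`. -/
def currentAction (N n : ℕ) : Current N →ₗ⁅ℂ⁆ Module.End ℂ (PolySpace N n) :=
  { (∑ s : Fin n, slot s : Current N →ₗ[ℂ] Module.End ℂ (PolySpace N n)) with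
    map_lie' := fun {A B} => by
      simp only [AddHom.toFun_eq_coe, LinearMap.coe_toAddHom, LinearMap.sum_apply,
        Ring.lie_def, map_sub, slot_mul, Finset.sum_mul_sum]
      rw [Finset.sum_comm (f := fun i j => slot i B * slot j A), ← Finset.sum_sub_distrib,
        ← Finset.sum_sub_distrib]
      refine Finset.sum_congr rfl fun s _ => ?_
      rw [← Finset.sum_sub_distrib]
      rw [Finset.sum_eq_single s]
      · intro s' _ hs
        rw [slot_comm hs.symm, sub_self]
      · intro h
        exact absurd (Finset.mem_univ s) h }

/-- The action of `U(gl_N[t])` on `(ℂ^N)^{⊗n} ⊗ ℂ[z_1, …, z_n]`. -/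
def uAction (N n : ℕ) : UCurrent N →ₐ[ℂ] Module.End ℂ (PolySpace N n) :=
  UniversalEnvelopingAlgebra.lift ℂ (currentAction N n)

/-- The action of a permutation: `σ` moves the factor in position `k` to position `σ k` and replaces
`z_k` by `z_{σ k}`. -/
def permAct {N n : ℕ} (σ : Equiv.Perm (Fin n)) : PolySpace N n →ₗ[ℂ] PolySpace N n where
  toFun f w := MvPolynomial.rename σ (f (w ∘ σ))
  map_add' f g := by
    ext1 w
    simp
  map_smul' c f := by
    ext1 w
    simp

/-- The subspace `V⁺` of `S_n`-invariants. -/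
def invariants (N n : ℕ) : Submodule ℂ (PolySpace N n) :=
  ⨅ σ : Equiv.Perm (Fin n), LinearMap.ker (permAct σ - LinearMap.id)

/-- The subspace `V⁻` of `S_n`-antiinvariants. -/
def antiinvariants (N n : ℕ) : Submodule ℂ (PolySpace N n) :=
  ⨅ σ : Equiv.Perm (Fin n),
    LinearMap.ker (permAct σ - ((Equiv.Perm.sign σ : ℤˣ) : ℤ) • LinearMap.id)

/-- The `gl_N`-weight subspace of weight `lam`: `e_{ii}` acts as `lam_i`. -/
def weightSpace {N : ℕ} (n : ℕ) (lam : Fin N → ℕ) : Submodule ℂ (PolySpace N n) :=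
  ⨅ i : Fin N, LinearMap.ker (uAction N n (uBasis i i 0) - (lam i : ℂ) • LinearMap.id)

/-- The weight subspace `V⁺_λ`. -/
def VPlus {N : ℕ} (n : ℕ) (lam : Fin N → ℕ) : Submodule ℂ (PolySpace N n) :=
  invariants N n ⊓ weightSpace n lam

/-- The weight subspace `V⁻_λ`. -/
def VMinus {N : ℕ} (n : ℕ) (lam : Fin N → ℕ) : Submodule ℂ (PolySpace N n) :=
  antiinvariants N n ⊓ weightSpace n lam

/-- The endomorphism `f` of the subspace `L` is the restriction to `L` of the action of `b`. -/
def ActsAs {N n : ℕ} {L : Submodule ℂ (PolySpace N n)} (f : Module.End ℂ L) (b : UCurrent N) :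
    Prop :=
  ∀ x : L, (f x : PolySpace N n) = uAction N n b x

/-- For a subspace `L` invariant under `B^∞`, this is the algebra `B^∞(L)`, the image of `B^∞` in
`End(L)`: it consists of the endomorphisms of `L` by which the elements of `B^∞` act. -/
def betheInfOn {N n : ℕ} (L : Submodule ℂ (PolySpace N n)) :
    Subalgebra ℂ (Module.End ℂ L) where
  carrier := {f | ∃ b ∈ betheInf N, ActsAs f b}
  mul_mem' := by
    rintro f g ⟨b, hb, hf⟩ ⟨c, hc, hg⟩
    refine ⟨b * c, mul_mem hb hc, fun x => ?_⟩
    rw [Module.End.mul_apply, hf, hg, map_mul, Module.End.mul_apply]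
  add_mem' := by
    rintro f g ⟨b, hb, hf⟩ ⟨c, hc, hg⟩
    refine ⟨b + c, add_mem hb hc, fun x => ?_⟩
    rw [LinearMap.add_apply, Submodule.coe_add, hf, hg, map_add, LinearMap.add_apply]
  algebraMap_mem' := fun r => by
    refine ⟨algebraMap ℂ _ r, Subalgebra.algebraMap_mem _ r, fun x => ?_⟩
    rw [AlgHom.commutes, Module.algebraMap_end_apply, Module.algebraMap_end_apply,
      Submodule.coe_smul]

/-! ### The equivariant cohomology algebra -/

/-- The polynomial algebra in the variables `z_s` (`s = 1, …, n`) and `γ_{ij}`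
(`i = 1, …, N`, `j = 1, …, λ_i`). -/
abbrev RootPoly {N : ℕ} (n : ℕ) (lam : Fin N → ℕ) : Type :=
  MvPolynomial (Fin n ⊕ (Σ i : Fin N, Fin (lam i))) ℂ

/-- The variable `z_s`. -/
def zVar {N n : ℕ} (lam : Fin N → ℕ) (s : Fin n) : RootPoly n lam :=
  MvPolynomial.X (Sum.inl s)

/-- The variable `γ_{ij}`. -/
def gammaVar {N : ℕ} (n : ℕ) (lam : Fin N → ℕ) (i : Fin N) (j : Fin (lam i)) : RootPoly n lam :=
  MvPolynomial.X (Sum.inr ⟨i, j⟩)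

/-- The subalgebra of invariants of `S_n × S_{λ_1} × ⋯ × S_{λ_N}`, where `S_n` permutes the `z_s`
and `S_{λ_i}` permutes the `γ_{ij}`. -/
def rootInvariants {N : ℕ} (n : ℕ) (lam : Fin N → ℕ) : Subalgebra ℂ (RootPoly n lam) where
  carrier := {p | ∀ (σ : Equiv.Perm (Fin n)) (τ : ∀ i : Fin N, Equiv.Perm (Fin (lam i))),
    MvPolynomial.rename (Sum.map σ (Sigma.map id fun i => τ i)) p = p}
  mul_mem' := fun {p q} hp hq σ τ => by rw [map_mul, hp σ τ, hq σ τ]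
  add_mem' := fun {p q} hp hq σ τ => by rw [map_add, hp σ τ, hq σ τ]
  algebraMap_mem' := fun r σ τ => by rw [AlgHom.commutes]

/-- The ideal of the invariant algebra generated by the relation
`∏_{i,j} (1 + u γ_{ij}) = ∏_s (1 + u z_s)`, that is, by the coefficients of the powers of `u` in the
difference of the two sides. -/
def relIdeal {N : ℕ} (n : ℕ) (lam : Fin N → ℕ) : Ideal (rootInvariants n lam) :=
  Ideal.span {x | ∃ k : ℕ, (x : RootPoly n lam) =
    ((∏ i : Fin N, ∏ j : Fin (lam i),
        (1 + Polynomial.X * Polynomial.C (gammaVar n lam i j)) -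
      ∏ s : Fin n, (1 + Polynomial.X * Polynomial.C (zVar lam s)) :
        Polynomial (RootPoly n lam))).coeff k}

/-- The algebra `H_λ = H^*_{GL_n}(F_λ, ℂ)` of the partial flag variety `F_λ`, in its presentation
by Chern roots: the `z_s` are the Chern roots of the torus of `GL_n`, and the `γ_{ij}` are those of
the bundle with fibre `F_i / F_{i-1}`. -/
abbrev EqCohomology {N : ℕ} (n : ℕ) (lam : Fin N → ℕ) : Type :=
  rootInvariants n lam ⧸ relIdeal n lam

theorem powerSum_mem {N : ℕ} (n : ℕ) (lam : Fin N → ℕ) (i : Fin N) (r : ℕ) :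
    ∑ j : Fin (lam i), gammaVar n lam i j ^ r ∈ rootInvariants n lam := by
  intro σ τ
  simp only [gammaVar, map_sum, map_pow, MvPolynomial.rename_X, Sum.map_inr, Sigma.map, id]
  exact Equiv.sum_comp (τ i)
    (fun j => (MvPolynomial.X (Sum.inr ⟨i, j⟩) : RootPoly n lam) ^ r)

/-- The class of `∑_j γ_{ij}^r` in `H_λ`. -/
def powerSumClass {N : ℕ} (n : ℕ) (lam : Fin N → ℕ) (i : Fin N) (r : ℕ) : EqCohomology n lam :=
  Ideal.Quotient.mk (relIdeal n lam)
    ⟨∑ j : Fin (lam i), gammaVar n lam i j ^ r, powerSum_mem n lam i r⟩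

/-! ### The maps `i⁺` and `i⁻` -/

/-- The block `I_i = {k | w_k = i}` of the decomposition of the positions given by `w`. -/
def block {N n : ℕ} (w : Fin n → Fin N) (i : Fin N) : Finset (Fin n) :=
  Finset.univ.filter fun k => w k = i

/-- The index set of the basis of weight `lam`: all blocks have the prescribed size. -/
def IsIndex {N n : ℕ} (lam : Fin N → ℕ) (w : Fin n → Fin N) : Prop :=
  ∀ i, (block w i).card = lam i

/-- The substitution `h(z, Γ_1, …, Γ_N) ↦ h(z, z_{I_1}, …, z_{I_N})`. Each block is listed in
increasing order, which does not matter for symmetric polynomials. -/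
def substPoly {N n : ℕ} (lam : Fin N → ℕ) (w : Fin n → Fin N) (hw : IsIndex lam w) :
    RootPoly n lam →ₐ[ℂ] MvPolynomial (Fin n) ℂ :=
  MvPolynomial.aeval (Sum.elim (fun s => MvPolynomial.X s)
    fun p => MvPolynomial.X ((block w p.1).orderEmbOfFin (hw p.1) p.2))

theorem prod_blocks {N n : ℕ} (lam : Fin N → ℕ) (w : Fin n → Fin N) (hw : IsIndex lam w)
    {M : Type*} [CommMonoid M] (f : Fin n → M) :
    ∏ i : Fin N, ∏ j : Fin (lam i), f ((block w i).orderEmbOfFin (hw i) j) = ∏ s, f s := by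
  rw [← Finset.prod_fiberwise Finset.univ w f]
  refine Finset.prod_congr rfl fun i _ => ?_
  have h : (Finset.univ.filter fun k => w k = i) =
      Finset.univ.map ((block w i).orderEmbOfFin (hw i)).toEmbedding := by
    rw [Finset.map_orderEmbOfFin_univ]
    rfl
  rw [h, Finset.prod_map]
  rfl

theorem substPoly_rel {N n : ℕ} (lam : Fin N → ℕ) (w : Fin n → Fin N) (hw : IsIndex lam w)
    (a : rootInvariants n lam) (ha : a ∈ relIdeal n lam) :
    ((substPoly lam w hw).comp (rootInvariants n lam).val) a = 0 := by
  have hle : relIdeal n lam ≤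
      RingHom.ker ((substPoly lam w hw).comp (rootInvariants n lam).val) := by
    refine Ideal.span_le.mpr ?_
    rintro x ⟨k, hk⟩
    rw [SetLike.mem_coe, RingHom.mem_ker]
    change substPoly lam w hw (x : RootPoly n lam) = 0
    rw [hk]
    have hc := Polynomial.coeff_map (f := (substPoly lam w hw : RootPoly n lam →+* MvPolynomial (Fin n) ℂ))
      (p := (∏ i : Fin N, ∏ j : Fin (lam i),
        (1 + Polynomial.X * Polynomial.C (gammaVar n lam i j)) -
      ∏ s : Fin n, (1 + Polynomial.X * Polynomial.C (zVar lam s)) :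
        Polynomial (RootPoly n lam))) k
    refine hc.symm.trans ?_
    simp only [Polynomial.map_sub, Polynomial.map_prod, Polynomial.map_add, Polynomial.map_one,
      Polynomial.map_mul, Polynomial.map_X, Polynomial.map_C, RingHom.coe_coe, substPoly,
      gammaVar, zVar, MvPolynomial.aeval_X, Sum.elim_inl, Sum.elim_inr]
    rw [prod_blocks lam w hw (fun s => (1 + Polynomial.X * Polynomial.C (MvPolynomial.X s) :
      Polynomial (MvPolynomial (Fin n) ℂ))), sub_self, Polynomial.coeff_zero]
  exact hle ha

/-- The substitution on classes, `[h] ↦ h(z, z_{I_1}, …, z_{I_N})`. -/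
def substClass {N n : ℕ} (lam : Fin N → ℕ) (w : Fin n → Fin N) (hw : IsIndex lam w) :
    EqCohomology n lam →ₐ[ℂ] MvPolynomial (Fin n) ℂ :=
  Ideal.Quotient.liftₐ (relIdeal n lam)
    ((substPoly lam w hw).comp (rootInvariants n lam).val) (substPoly_rel lam w hw)

open Classical in
/-- The map `i⁺_λ : [h] ↦ ∑_I v_I ⊗ h(z, z_{I_1}, …, z_{I_N})`. -/
def iPlus {N : ℕ} (n : ℕ) (lam : Fin N → ℕ) : EqCohomology n lam →ₗ[ℂ] PolySpace N n :=
  LinearMap.pi fun w : Fin n → Fin N =>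
    if hw : IsIndex lam w then (substClass lam w hw).toLinearMap else 0

/-- The field of rational functions in `z_1, …, z_n`. -/
abbrev RatFun (n : ℕ) : Type := FractionRing (MvPolynomial (Fin n) ℂ)

/-- `(ℂ^N)^{⊗n}`-valued rational functions, in coordinates. -/
abbrev RatSpace (N n : ℕ) : Type := (Fin n → Fin N) → RatFun n

/-- `R(z_{I_1} | … | z_{I_N}) = ∏_{i < j} ∏_{a ∈ I_i, b ∈ I_j} (z_b - z_a)`. -/
def blockR {N n : ℕ} (w : Fin n → Fin N) : MvPolynomial (Fin n) ℂ :=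
  ∏ i : Fin N, ∏ j ∈ Finset.Ioi i, ∏ a ∈ block w i, ∏ b ∈ block w j,
    (MvPolynomial.X b - MvPolynomial.X a)

/-- `D = ∏_{i < j} (z_j - z_i)`. -/
def discD (n : ℕ) : MvPolynomial (Fin n) ℂ :=
  ∏ i : Fin n, ∏ j ∈ Finset.Ioi i, (MvPolynomial.X j - MvPolynomial.X i)

open Classical in
/-- The map `i⁻_λ : [h] ↦ ∑_I v_I ⊗ h(z, z_{I_1}, …, z_{I_N}) / R(z_{I_1} | … | z_{I_N})`. -/
def iMinus {N : ℕ} (n : ℕ) (lam : Fin N → ℕ) : EqCohomology n lam →ₗ[ℂ] RatSpace N n :=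
  LinearMap.pi fun w : Fin n → Fin N =>
    if hw : IsIndex lam w then
      (algebraMap (MvPolynomial (Fin n) ℂ) (RatFun n) (blockR w))⁻¹ •
        ((IsScalarTower.toAlgHom ℂ (MvPolynomial (Fin n) ℂ) (RatFun n)).toLinearMap ∘ₗ
          (substClass lam w hw).toLinearMap)
    else 0

/-- The map `x ↦ x / D`. -/
def divD (N n : ℕ) : PolySpace N n →ₗ[ℂ] RatSpace N n :=
  LinearMap.pi fun w : Fin n → Fin N =>
    (algebraMap (MvPolynomial (Fin n) ℂ) (RatFun n) (discD n))⁻¹ •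
      ((IsScalarTower.toAlgHom ℂ (MvPolynomial (Fin n) ℂ) (RatFun n)).toLinearMap ∘ₗ
        LinearMap.proj w)

end FlagBethe

end

open FlagBethe

noncomputable section
namespace FlagBethe

/-! ### Expansion of the universal differential operator -/

/-! Everything reduces to the fact that `betheInf N` is generated by the diagonal currents `uBasis i
i r` (`betheInf_eq_adjoin`). In the row determinant, `K_i` occurs only in the diagonal entry of row
`i`. Hence the coefficient of `∏_{a ∈ I} K_a` comes from the permutations fixing `I` pointwise. The
identity contributes a monic operator of order `N - |I|` with subleading coefficient `-∑_{a ∉ I}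
e_{aa}(u)`, up to sign. Any other permutation moves at least two points and contributes order at
most `N - |I| - 2`. So for `j > 0` only monomials of degree at most `i - 1` occur in `B^K_{ij}`. In
the given regime `K_1 ⋯ K_{i-1}` dominates them, and the leading term is `±∑_{a ≥ i} e_{aa} ⊗
t^{j-1}`. Differences of these sums isolate each current.

On coordinates, `e_{ii} ⊗ t^r` is multiplication by the power sum of the variables in block `I_i`.
An invariant or antiinvariant vector of weight `λ` is determined by one coordinate, since `S_n`
permutes the decompositions transitively. In the invariant case that coordinate is an arbitrary
polynomial fixed by the stabilizer of the decomposition. In the antiinvariant case it is such a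
polynomial times `D / R_I`, which up to sign is the product of the differences inside blocks
(`blockVandermonde_dvd`).

The relations of `H_λ` eliminate the `z_s` (`exists_gamma_rep`), after which substituting a
decomposition is an injective renaming (`substClass_injective`). Its image contains all
stabilizer-invariant polynomials because these are generated by power sums
(`mem_adjoin_colourPsum`). This gives both bijections. They turn multiplication by `powerSumClass`
into the action of the currents; as these classes generate `H_λ`, the Bethe algebra acts as the
algebra of all multiplications (`exists_betheInfOn_equiv`). -/

theorem ofFn_prod_apply_induction {R M A : Type*} [Semiring R] [AddCommMonoid M] [Module R M]
    [AddCommMonoid A] (P : A → M → Prop) :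
    ∀ {m : ℕ} (T : Fin m → Module.End R M) (δ : Fin m → A),
      (∀ i a x, P a x → P (a + δ i) (T i x)) → ∀ a x, P a x →
      P (a + ∑ i, δ i) ((List.ofFn T).prod x)
  | 0, _, _, _, a, x, hx => by simpa using hx
  | m + 1, T, δ, h, a, x, hx => by
    have h1 := ofFn_prod_apply_induction P (fun i : Fin m => T i.succ) (fun i => δ i.succ)
      (fun i => h i.succ) a x hx
    have h2 := h 0 _ _ h1
    rw [List.ofFn_succ, List.prod_cons, Module.End.mul_apply, Fin.sum_univ_succ,
      add_comm (δ 0), ← add_assoc]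
    exact h2

theorem ofFn_prod_add_smul_one {A : Type*} [Ring A] [Algebra ℂ A] {N : ℕ} (M : Fin N → A)
    (c : Fin N → ℂ) :
    (List.ofFn fun i => c i • (1 : A) + M i).prod =
      ∑ s : Finset (Fin N), (∏ i ∈ s, c i) • (List.ofFn fun i => if i ∈ s then 1 else M i).prod := by
  have h := (MultilinearMap.mkPiAlgebraFin ℂ N A).map_add_univ (fun i => c i • (1 : A)) M
  simp only [MultilinearMap.mkPiAlgebraFin_apply] at h
  refine h.trans (Finset.sum_congr rfl fun s _ => ?_)
  have h2 := (MultilinearMap.mkPiAlgebraFin ℂ N A).map_piecewise_smul c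
    (fun i => if i ∈ s then 1 else M i) s
  simp only [MultilinearMap.mkPiAlgebraFin_apply] at h2
  rw [← h2]
  congr 2
  funext i
  by_cases hi : i ∈ s <;> simp [hi]

/-- The part of the entry `(i, σ i)` of the Bethe matrix which does not depend on `K`. -/
def entryZero {N : ℕ} (σ : Equiv.Perm (Fin N)) (i : Fin N) : Module.End ℂ (DiffOp N) :=
  (if i = σ i then leftDer N else 0) - leftMul (genSeries (σ i) i)

theorem betheMatrix_apply_perm {N : ℕ} (K : Fin N → ℂ) (σ : Equiv.Perm (Fin N)) (i : Fin N) :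
    betheMatrix K i (σ i) = (if i = σ i then -K i else 0) • (1 : Module.End ℂ (DiffOp N))
      + entryZero σ i := by
  have h1 : ∀ {V : Type} [AddCommGroup V] [Module ℂ V] (c : ℂ) (f g : Module.End ℂ V),
      f - c • (1 : Module.End ℂ V) - g = -c • 1 + (f - g) := by
    intro V _ _ c f g
    rw [neg_smul]; abel
  have h2 : ∀ {V : Type} [AddCommGroup V] [Module ℂ V] (g : Module.End ℂ V),
      0 - g = (0 : ℂ) • 1 + (0 - g) := by
    intro V _ _ g
    rw [zero_smul, zero_add]
  unfold betheMatrix entryZero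
  split_ifs
  · exact h1 _ _ _
  · exact h2 _

/-- The product over the rows outside `I` of the `K`-independent parts of the entries. -/
def partialProd {N : ℕ} (σ : Equiv.Perm (Fin N)) (I : Finset (Fin N)) : DiffOp N :=
  (List.ofFn fun i => if i ∈ I then 1 else entryZero σ i).prod (Finsupp.single 0 1)

/-- The coefficient of `∏_{i ∈ I} K_i` in the universal differential operator. -/
def opCoeff {N : ℕ} (I : Finset (Fin N)) : DiffOp N :=
  ∑ σ : Equiv.Perm (Fin N), ((Equiv.Perm.sign σ : ℤˣ) : ℤ) •
    (∏ i ∈ I, if i = σ i then (-1 : ℂ) else 0) • partialProd σ I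

theorem universalOp_eq_sum {N : ℕ} (K : Fin N → ℂ) :
    universalOp K = ∑ I : Finset (Fin N), (∏ i ∈ I, K i) • opCoeff I := by
  -- Nothing about differential operators enters here: scalars are central, so multilinear expansion
  -- of the ordered products suffices.
  have key : ∀ {V : Type} [AddCommGroup V] [Module ℂ V]
      (M : Equiv.Perm (Fin N) → Fin N → Module.End ℂ V) (x : V),
      (∑ σ : Equiv.Perm (Fin N), ((Equiv.Perm.sign σ : ℤˣ) : ℤ) •
        (List.ofFn fun i => (if i = σ i then -K i else 0) • (1 : Module.End ℂ V) + M σ i).prod) x =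
      ∑ I : Finset (Fin N), (∏ i ∈ I, K i) • ∑ σ : Equiv.Perm (Fin N),
        ((Equiv.Perm.sign σ : ℤˣ) : ℤ) • (∏ i ∈ I, if i = σ i then (-1 : ℂ) else 0) •
          (List.ofFn fun i => if i ∈ I then 1 else M σ i).prod x := by
    intro V _ _ M x
    simp only [ofFn_prod_add_smul_one, LinearMap.sum_apply, LinearMap.smul_apply, Finset.smul_sum]
    rw [Finset.sum_comm]
    refine Finset.sum_congr rfl fun I _ => Finset.sum_congr rfl fun σ _ => ?_
    rw [smul_comm (∏ i ∈ I, K i), smul_smul (∏ i ∈ I, K i), ← Finset.prod_mul_distrib]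
    congr 2
    refine Finset.prod_congr rfl fun i _ => ?_
    split_ifs <;> simp
  unfold universalOp rdet opCoeff partialProd
  simp only [betheMatrix_apply_perm]
  exact key _ _

theorem leftDer_apply_zero {N : ℕ} (x : DiffOp N) : leftDer N x 0 = uDeriv N (x 0) := by
  have : (Finsupp.mapDomain Nat.succ x) 0 = 0 :=
    Finsupp.mapDomain_of_notMem_range _ _ (by simp)
  simp [leftDer, this]

theorem leftDer_apply_succ {N : ℕ} (x : DiffOp N) (k : ℕ) :
    leftDer N x (k + 1) = x k + uDeriv N (x (k + 1)) := by
  have : (Finsupp.mapDomain Nat.succ x) (k + 1) = x k :=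
    Finsupp.mapDomain_apply Nat.succ_injective x k
  simp [leftDer, this]

theorem leftMul_apply {N : ℕ} (b : USeries N) (x : DiffOp N) (k : ℕ) :
    leftMul b x k = b * x k := by
  simp [leftMul]

theorem uDeriv_one (N : ℕ) : uDeriv N 1 = 0 := by
  ext m
  rcases m with _ | _ | m <;> simp [uDeriv, PowerSeries.coeff_one]

/-- Only diagonal entries contain `∂`, so a row raises the order by one exactly when `σ` fixes it.
-/
theorem entryZero_degree {N : ℕ} (σ : Equiv.Perm (Fin N)) (i : Fin N) (d : ℕ) (x : DiffOp N)
    (hx : ∀ k, d < k → x k = 0) (k : ℕ) (hk : d + (if i = σ i then 1 else 0) < k) :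
    entryZero σ i x k = 0 := by
  unfold entryZero
  have hdk : d < k := by omega
  split_ifs at hk ⊢ with h
  · rw [LinearMap.sub_apply, Finsupp.sub_apply, leftMul_apply, hx k hdk]
    obtain ⟨l, rfl⟩ : ∃ l, k = l + 1 := ⟨k - 1, by omega⟩
    rw [leftDer_apply_succ, hx l (by omega), hx _ hdk]
    simp
  · rw [LinearMap.sub_apply, Finsupp.sub_apply, leftMul_apply, hx k hdk]
    simp

theorem partialProd_degree {N : ℕ} (σ : Equiv.Perm (Fin N)) (I : Finset (Fin N)) (k : ℕ)
    (hk : (Finset.univ.filter fun i => i ∉ I ∧ i = σ i).card < k) : partialProd σ I k = 0 := by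
  have h := ofFn_prod_apply_induction (fun d (x : DiffOp N) => ∀ k, d < k → x k = 0)
    (fun i => if i ∈ I then 1 else entryZero σ i)
    (fun i => if i ∉ I ∧ i = σ i then 1 else 0) ?_ 0 (Finsupp.single 0 1) ?_
  · refine h k ?_
    rw [zero_add, ← Finset.card_filter]
    exact hk
  · intro i d x hx k hk
    by_cases hi : i ∈ I
    · simp only [hi, if_true, Module.End.one_apply]
      exact hx k (by omega)
    · simp only [hi, if_false]
      refine entryZero_degree σ i d x hx k ?_
      simpa [hi] using hk
  · intro k hk
    rw [Finsupp.single_apply, if_neg hk.ne]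

/-- The factors are `∂ - e_{ii}(u)`. Moving `∂` past the subleading coefficient affects only lower
orders, and the leading coefficient `1` has zero derivative, so the two top coefficients behave as
in the commutative case. -/
theorem partialProd_one {N : ℕ} (I : Finset (Fin N)) :
    (∀ k, Iᶜ.card < k → partialProd 1 I k = 0) ∧ partialProd 1 I Iᶜ.card = 1 ∧
      ∀ k, k + 1 = Iᶜ.card → partialProd 1 I k = -∑ i ∈ Iᶜ, genSeries i i := by
  -- The pair `a` records the order and the subleading coefficient. The last clause fixes the latter
  -- to `0` at order zero, where no such coefficient exists.
  have h := ofFn_prod_apply_induction (fun (a : ℕ × USeries N) (x : DiffOp N) =>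
      (∀ k, a.1 < k → x k = 0) ∧ x a.1 = 1 ∧ (∀ k, k + 1 = a.1 → x k = a.2) ∧
        (a.1 = 0 → a.2 = 0))
    (fun i => if i ∈ I then 1 else entryZero 1 i)
    (fun i => if i ∈ I then 0 else (1, -genSeries i i)) ?_ 0 (Finsupp.single 0 1) ?_
  · have hs : (∑ i : Fin N, if i ∈ I then (0 : ℕ × USeries N) else (1, -genSeries i i)) =
        (Iᶜ.card, -∑ i ∈ Iᶜ, genSeries i i) := by
      have : ∀ i, (if i ∈ I then (0 : ℕ × USeries N) else (1, -genSeries i i)) =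
          if i ∈ Iᶜ then (1, -genSeries i i) else 0 := fun i => by
        by_cases hi : i ∈ I <;> simp [hi]
      rw [Finset.sum_congr rfl fun i _ => this i, Finset.sum_ite_mem, Finset.univ_inter]
      refine Prod.ext ?_ ?_
      · simp [Prod.fst_sum]
      · simp [Prod.snd_sum]
    rw [zero_add, hs] at h
    exact ⟨h.1, h.2.1, h.2.2.1⟩
  · rintro i ⟨d, b⟩ x ⟨h1, h2, h3, h4⟩
    by_cases hi : i ∈ I
    · simpa [hi] using ⟨h1, h2, h3, h4⟩
    · simp only [hi, if_false, Prod.mk_add_mk]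
      simp only at h1 h2 h3 h4
      have he : ∀ k, entryZero 1 i x k = leftDer N x k - genSeries i i * x k := fun k => by
        simp [entryZero, leftMul_apply]
      refine ⟨fun k hk => ?_, ?_, fun k hk => ?_, by simp⟩
      · exact entryZero_degree 1 i d x h1 k (by simpa using hk)
      · rw [he, leftDer_apply_succ, h2, h1 (d + 1) (by omega)]
        simp
      · obtain rfl : k = d := by omega
        rw [he, h2]
        rcases k with _ | k
        · rw [leftDer_apply_zero, h2, uDeriv_one, h4 rfl]
          simp
        · rw [leftDer_apply_succ, h2, uDeriv_one, h3 k rfl]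
          simp [sub_eq_add_neg]
  · refine ⟨fun k hk => ?_, ?_, ?_, ?_⟩
    · have hk' : 0 < k := hk
      rw [Finsupp.single_apply, if_neg hk'.ne]
    · simp
    · simp
    · simp

theorem card_fixed_add_two_le {N : ℕ} {σ : Equiv.Perm (Fin N)} (hσ : σ ≠ 1) {I : Finset (Fin N)}
    (hI : ∀ i ∈ I, i = σ i) :
    (Finset.univ.filter fun i => i ∉ I ∧ i = σ i).card + I.card + 2 ≤ N := by
  have h2 := Equiv.Perm.two_le_card_support_of_ne_one hσ
  have hd1 : Disjoint (Finset.univ.filter fun i => i ∉ I ∧ i = σ i) I := by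
    rw [Finset.disjoint_left]; intro i hi; simp at hi; exact hi.1
  have hd2 : Disjoint ((Finset.univ.filter fun i => i ∉ I ∧ i = σ i) ∪ I) σ.support := by
    rw [Finset.disjoint_left]
    intro i hi
    rw [Equiv.Perm.mem_support, not_not]
    rcases Finset.mem_union.1 hi with h | h
    · simp at h; exact h.2.symm
    · exact (hI i h).symm
  have h3 := Finset.card_le_univ (((Finset.univ.filter fun i => i ∉ I ∧ i = σ i) ∪ I) ∪ σ.support)
  rw [Finset.card_union_of_disjoint hd2, Finset.card_union_of_disjoint hd1, Fintype.card_fin] at h3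
  omega

/-- A non-identity permutation either moves a row of `I`, so that no `K_i` is available there, or
has order at most `N - |I| - 2`, below the range of `k`. -/
theorem opCoeff_apply {N : ℕ} (I : Finset (Fin N)) (k : ℕ) (hk : N ≤ k + I.card + 1) :
    opCoeff I k = (-1 : ℂ) ^ I.card • partialProd 1 I k := by
  unfold opCoeff
  rw [Finsupp.finsetSum_apply, Finset.sum_eq_single 1]
  · simp
  · intro σ _ hσ
    rw [Finsupp.smul_apply, Finsupp.smul_apply]
    by_cases hI : ∀ i ∈ I, i = σ i
    · have := card_fixed_add_two_le hσ hI
      rw [partialProd_degree σ I k (by omega)]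
      simp
    · push Not at hI
      obtain ⟨i, hi, h⟩ := hI
      rw [Finset.prod_eq_zero hi (if_neg h)]
      simp
  · simp

theorem betheCoeff_eq_sum {N : ℕ} (K : Fin N → ℂ) (i j : ℕ) :
    betheCoeff K i j = ∑ I : Finset (Fin N), (∏ a ∈ I, K a) •
      PowerSeries.coeff j (opCoeff I (N - i)) := by
  unfold betheCoeff
  rw [universalOp_eq_sum, Finsupp.finsetSum_apply, map_sum]
  rfl

/-- Order `N - i` is here either the top order, with constant coefficient, or above it; neither
contains `u^{-j}` with `j > 0`. -/
theorem coeff_opCoeff_of_le_card {N : ℕ} {i j : ℕ} (hi : i ≤ N) (hj : j ≠ 0)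
    {I : Finset (Fin N)} (hI : i ≤ I.card) : PowerSeries.coeff j (opCoeff I (N - i)) = 0 := by
  obtain ⟨h1, h2, -⟩ := partialProd_one I
  have hc : Iᶜ.card + I.card = N := by
    rw [Finset.card_compl_add_card, Fintype.card_fin]
  rw [opCoeff_apply I _ (by omega)]
  rcases hI.eq_or_lt with h | h
  · rw [show N - i = Iᶜ.card by omega, h2, PowerSeries.coeff_smul, PowerSeries.coeff_one, if_neg hj,
      smul_zero]
  · rw [h1 _ (by omega), smul_zero, map_zero]

/-- This is the subleading coefficient. The sign combines `(-1)^{|I|}` from the `-K_a` with one more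
from `-e_{aa}(u)`. -/
theorem coeff_opCoeff_of_card {N : ℕ} {i j : ℕ} (hi : i ≤ N)
    {I : Finset (Fin N)} (hI : I.card + 1 = i) :
    PowerSeries.coeff (j + 1) (opCoeff I (N - i)) =
      (-1 : ℂ) ^ i • ∑ a ∈ Iᶜ, uBasis a a j := by
  obtain ⟨-, -, h3⟩ := partialProd_one I
  have hc : Iᶜ.card + I.card = N := by
    rw [Finset.card_compl_add_card, Fintype.card_fin]
  rw [opCoeff_apply I _ (by omega), h3 _ (by omega), PowerSeries.coeff_smul, map_neg, map_sum, ← hI,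
    pow_succ, mul_neg_one, neg_smul, smul_neg]
  simp [genSeries]

/-- At `u = ∞` the series `e_{ij}(u)` and all derivatives vanish, leaving only `∂ - K_i`. Thus the
elements with `j = 0` have only scalar leading terms. -/
theorem coeff_zero_universalOp {N : ℕ} (K : Fin N → ℂ) (k : ℕ) :
    PowerSeries.coeff 0 (universalOp K k) ∈ Submodule.span ℂ {(1 : UCurrent N)} := by
  let W : Submodule ℂ (UCurrent N) := Submodule.span ℂ {(1 : UCurrent N)}
  have hent : ∀ (i j : Fin N) (x : DiffOp N), (∀ k, PowerSeries.coeff 0 (x k) ∈ W) →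
      ∀ k, PowerSeries.coeff 0 (betheMatrix K i j x k) ∈ W := by
    intro i j x hx k
    have hm : PowerSeries.coeff 0 (leftMul (genSeries j i) x k) = 0 := by
      rw [leftMul_apply]
      simp [genSeries]
    have hd : PowerSeries.coeff 0 (leftDer N x k) ∈ W := by
      have hu : ∀ f, PowerSeries.coeff 0 (uDeriv N f) = 0 := fun f => by simp [uDeriv]
      rcases k with _ | k
      · rw [leftDer_apply_zero, hu]; exact zero_mem _
      · rw [leftDer_apply_succ, map_add, hu, add_zero]; exact hx k
    unfold betheMatrix
    rw [LinearMap.sub_apply, Finsupp.sub_apply, map_sub, hm, sub_zero]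
    split_ifs
    · rw [LinearMap.sub_apply, Finsupp.sub_apply, map_sub]
      refine sub_mem hd ?_
      rw [LinearMap.smul_apply, Finsupp.smul_apply, PowerSeries.coeff_smul]
      exact W.smul_mem _ (hx k)
    · simp
  unfold universalOp rdet
  rw [LinearMap.sum_apply, Finsupp.finsetSum_apply, map_sum]
  refine sum_mem fun σ _ => ?_
  rw [LinearMap.smul_apply, Finsupp.smul_apply, map_zsmul]
  refine zsmul_mem ?_ _
  have h := ofFn_prod_apply_induction (A := ℕ)
    (fun _ (x : DiffOp N) => ∀ k, PowerSeries.coeff 0 (x k) ∈ W)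
    (fun i => betheMatrix K i (σ i)) (fun _ => 0) (fun i _ x hx => hent i (σ i) x hx) 0
    (Finsupp.single 0 1) ?_
  · exact h k
  · intro k
    rw [Finsupp.single_apply]
    split_ifs
    · rw [PowerSeries.coeff_one, if_pos rfl]
      exact Submodule.mem_span_singleton_self _
    · simp
end FlagBethe
end
noncomputable section
namespace FlagBethe

attribute [local instance] LieRing.ofAssociativeRing

/-! ### Leading terms and the limiting Bethe algebra -/

theorem tendsto_zone_apply {N : ℕ} (i : Fin N) :
    Filter.Tendsto (fun K : Fin N → ℂ => K i) (zone N) (Bornology.cobounded ℂ) :=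
  Filter.tendsto_iff_comap.2 (inf_le_left.trans (iInf_le _ i))

theorem tendsto_zone_div {N : ℕ} {i j : Fin N} (h : (i : ℕ) + 1 = j) :
    Filter.Tendsto (fun K : Fin N → ℂ => K i / K j) (zone N) (Bornology.cobounded ℂ) :=
  Filter.tendsto_iff_comap.2 (inf_le_right.trans ((iInf_le _ i).trans ((iInf_le _ j).trans
    (iInf_le _ h))))

theorem eventually_zone_ne_zero (N : ℕ) : ∀ᶠ K in zone N, ∀ i, K i ≠ 0 :=
  Filter.eventually_all.2 fun i =>
    (tendsto_zone_apply i).eventually (Bornology.eventually_ne_cobounded 0)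

/-- The curve `K_i = t^{N-i}` (indices from `0`) stays in the regime as `t → ∞`. Nontriviality of
the filter is what makes limits unique. -/
instance zone_neBot (N : ℕ) : (zone N).NeBot := by
  have hc : Filter.Tendsto (fun t : ℝ => (t : ℂ)) Filter.atTop (Bornology.cobounded ℂ) := by
    rw [← tendsto_norm_atTop_iff_cobounded]
    simpa using Filter.tendsto_abs_atTop_atTop
  have h : Filter.Tendsto (fun (t : ℝ) (i : Fin N) => (t : ℂ) ^ (N - (i : ℕ))) Filter.atTop
      (zone N) := by
    refine Filter.tendsto_inf.2 ⟨Filter.tendsto_iInf.2 fun i => Filter.tendsto_comap_iff.2 ?_,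
      Filter.tendsto_iInf.2 fun i => Filter.tendsto_iInf.2 fun j => Filter.tendsto_iInf.2 fun hij =>
        Filter.tendsto_comap_iff.2 ?_⟩
    · rw [← tendsto_norm_atTop_iff_cobounded]
      have := (Filter.tendsto_pow_atTop (α := ℝ) (n := N - (i : ℕ)) (by omega)).comp
        Filter.tendsto_abs_atTop_atTop
      refine this.congr fun t => ?_
      simp
    · refine hc.congr' ?_
      filter_upwards [Filter.eventually_gt_atTop 0] with t ht
      have ht' : (t : ℂ) ≠ 0 := by exact_mod_cast ht.ne'
      have he : N - (i : ℕ) = (N - (j : ℕ)) + 1 := by omega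
      simp only [Function.comp_apply]
      rw [he, pow_succ, mul_comm, mul_div_assoc, div_self (pow_ne_zero _ ht'), mul_one]
  exact h.neBot

/-- The successive ratios of a tuple, extended by `1` on the right. -/
def succRatio {N : ℕ} (K : Fin N → ℂ) (l : ℕ) : ℂ :=
  (if h : l < N then K ⟨l, h⟩ else 1) / (if h : l + 1 < N then K ⟨l + 1, h⟩ else 1)

theorem tendsto_succRatio {N : ℕ} {l : ℕ} (hl : l < N) :
    Filter.Tendsto (fun K : Fin N → ℂ => succRatio K l) (zone N) (Bornology.cobounded ℂ) := by
  unfold succRatio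
  by_cases h : l + 1 < N
  · simpa only [hl, h, dif_pos] using tendsto_zone_div (i := ⟨l, hl⟩) (j := ⟨l + 1, h⟩) rfl
  · simpa only [hl, h, dif_pos, dif_neg, not_false_eq_true, div_one] using
      tendsto_zone_apply (⟨l, hl⟩ : Fin N)

theorem prod_succRatio {N : ℕ} {K : Fin N → ℂ} (hK : ∀ i, K i ≠ 0) (i : Fin N) :
    ∏ l ∈ Finset.Ico (i : ℕ) N, succRatio K l = K i := by
  have hne : ∀ l, (if h : l < N then K ⟨l, h⟩ else 1) ≠ 0 := fun l => by
    split_ifs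
    · exact hK _
    · exact one_ne_zero
  have h : ∀ m, (i : ℕ) ≤ m → ∏ l ∈ Finset.Ico (i : ℕ) m, succRatio K l =
      K i / (if h : m < N then K ⟨m, h⟩ else 1) := by
    intro m hm
    induction m, hm using Nat.le_induction with
    | base => simp [i.2, hK]
    | succ m hm ih =>
      rw [Finset.prod_Ico_succ_top hm, ih, succRatio, div_mul_div_cancel₀ (hne m)]
  rw [h N i.2.le]
  simp

/-- Each `K_i` telescopes into the ratios of index at least `i`. All these ratios tend to infinity,
so monomials can be compared by their exponents. -/
theorem prod_eq_prod_succRatio {N : ℕ} {K : Fin N → ℂ} (hK : ∀ i, K i ≠ 0) (I : Finset (Fin N)) :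
    ∏ i ∈ I, K i =
      ∏ l ∈ Finset.range N, succRatio K l ^ (I.filter fun i : Fin N => (i : ℕ) ≤ l).card := by
  have h : ∀ i : Fin N, K i = ∏ l ∈ Finset.range N, if (i : ℕ) ≤ l then succRatio K l else 1 := by
    intro i
    rw [← Finset.prod_filter]
    nth_rw 1 [← prod_succRatio hK i]
    refine Finset.prod_congr ?_ fun _ _ => rfl
    ext l; simp [and_comm]
  rw [Finset.prod_congr rfl fun i _ => h i, Finset.prod_comm]
  refine Finset.prod_congr rfl fun l _ => ?_
  rw [← Finset.prod_filter, Finset.prod_const]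

/-- The first `m` indices. -/
def initialSet (N m : ℕ) : Finset (Fin N) := Finset.univ.filter fun i => (i : ℕ) < m

theorem card_fin_filter_lt {N m : ℕ} (hm : m ≤ N) :
    (Finset.univ.filter fun i : Fin N => (i : ℕ) < m).card = m := by
  rw [← Finset.card_map Fin.valEmbedding]
  conv_rhs => rw [← Finset.card_range m]
  congr 1
  ext a
  simp only [Finset.mem_map, Finset.mem_filter, Finset.mem_univ, true_and, Finset.mem_range,
    Fin.valEmbedding_apply]
  exact ⟨fun ⟨b, hb, h⟩ => h ▸ hb, fun h => ⟨⟨a, by omega⟩, h, rfl⟩⟩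

theorem card_initialSet {N m : ℕ} (hm : m ≤ N) : (initialSet N m).card = m :=
  card_fin_filter_lt hm

theorem card_initialSet_filter {N m l : ℕ} (hm : m ≤ N) :
    ((initialSet N m).filter fun i : Fin N => (i : ℕ) ≤ l).card = min m (l + 1) := by
  rw [← card_fin_filter_lt (N := N) (m := min m (l + 1)) (by omega), initialSet,
    Finset.filter_filter]
  congr 1
  ext i
  simp only [Finset.mem_filter, Finset.mem_univ, true_and]
  omega

theorem card_filter_le {N : ℕ} (I : Finset (Fin N)) (l : ℕ) :
    (I.filter fun i : Fin N => (i : ℕ) ≤ l).card ≤ min I.card (l + 1) := by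
  refine le_min (Finset.card_filter_le _ _) ?_
  rw [← Finset.card_map Fin.valEmbedding, ← Finset.card_range (l + 1)]
  refine Finset.card_le_card fun a ha => ?_
  simp only [Finset.mem_map, Finset.mem_filter, Fin.valEmbedding_apply] at ha
  obtain ⟨b, hb, rfl⟩ := ha
  simp only [Finset.mem_range]
  omega

/-- At most `min m (l + 1)` elements of `I` are `≤ l`, and the initial set attains this for every
`l`. The quotient is therefore a product of nonnegative powers of inverse ratios, one of them
positive. -/
theorem tendsto_prod_div_initialSet {N m : ℕ} (hm : m ≤ N) {I : Finset (Fin N)}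
    (hI : I.card ≤ m) (hne : I ≠ initialSet N m) :
    Filter.Tendsto (fun K : Fin N → ℂ => (∏ i ∈ I, K i) / ∏ i ∈ initialSet N m, K i) (zone N)
      (nhds 0) := by
  set c : ℕ → ℕ := fun l => (I.filter fun i : Fin N => (i : ℕ) ≤ l).card with hc
  have hle : ∀ l, c l ≤ min m (l + 1) := fun l =>
    (card_filter_le I l).trans (min_le_min_right _ hI)
  -- An element `j` of the initial set missing from `I` gives the strict inequality: at most `j`
  -- elements of `I` are `≤ j`, against `j + 1`.
  obtain ⟨j, hj, hjI⟩ : ∃ j ∈ initialSet N m, j ∉ I := by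
    by_contra! h
    exact hne (Finset.eq_of_subset_of_card_le h (by rw [card_initialSet hm]; exact hI)).symm
  have hlt : c j < min m ((j : ℕ) + 1) := by
    have hj' : (j : ℕ) < m := by simpa [initialSet] using hj
    have h1 : c j ≤ j := by
      simp only [hc, Fin.val_fin_le]
      have : (I.filter fun i : Fin N => i ≤ j) ⊆ Finset.Iio j := fun i hi => by
        simp only [Finset.mem_filter] at hi
        refine Finset.mem_Iio.2 (lt_of_le_of_ne hi.2 fun h => hjI (h ▸ hi.1))
      simpa using Finset.card_le_card this
    omega
  have heq : ∀ᶠ K : Fin N → ℂ in zone N,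
      ∏ l ∈ Finset.range N, (succRatio K l)⁻¹ ^ (min m (l + 1) - c l) =
        (∏ i ∈ I, K i) / ∏ i ∈ initialSet N m, K i := by
    filter_upwards [eventually_zone_ne_zero N] with K hK
    rw [prod_eq_prod_succRatio hK I, prod_eq_prod_succRatio hK (initialSet N m),
      ← Finset.prod_div_distrib]
    refine Finset.prod_congr rfl fun l hl => ?_
    have hx : succRatio K l ≠ 0 := by
      unfold succRatio
      refine div_ne_zero ?_ ?_ <;> split_ifs <;> first | exact hK _ | exact one_ne_zero
    rw [card_initialSet_filter hm, inv_pow, pow_sub₀ _ hx (hle l), mul_inv, inv_inv, mul_comm,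
      div_eq_mul_inv]
  refine Filter.Tendsto.congr' heq ?_
  have h0 : ∏ l ∈ Finset.range N, (0 : ℂ) ^ (min m (l + 1) - c l) = 0 :=
    Finset.prod_eq_zero (Finset.mem_range.2 j.2) (zero_pow (by omega))
  rw [← h0]
  exact tendsto_finsetProd _ fun l hl =>
    (Filter.tendsto_inv₀_cobounded.comp (tendsto_succRatio (Finset.mem_range.1 hl))).pow _

theorem isLeadingTerm_of_card_le {N m : ℕ} (hm : m ≤ N) (d : Finset (Fin N) → UCurrent N)
    (hd : ∀ I, d I ≠ 0 → I.card ≤ m) (h0 : d (initialSet N m) ≠ 0) :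
    IsLeadingTerm (fun K => ∑ I : Finset (Fin N), (∏ i ∈ I, K i) • d I) (d (initialSet N m)) := by
  refine ⟨h0, fun i => if i ∈ initialSet N m then 1 else 0, fun φ => ?_⟩
  have hp : ∀ K : Fin N → ℂ, ∏ i, K i ^ (if i ∈ initialSet N m then 1 else 0) =
      ∏ i ∈ initialSet N m, K i := fun K => by
    simp [pow_ite, Finset.prod_ite_mem]
  simp only [hp, map_sum, map_smul, smul_eq_mul, Finset.sum_div, mul_div_right_comm]
  have hs : φ (d (initialSet N m)) =
      ∑ I : Finset (Fin N), (if I = initialSet N m then 1 else 0) * φ (d I) := by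
    simp
  rw [hs]
  refine tendsto_finsetSum _ fun I _ => ?_
  split_ifs with h
  · refine Filter.Tendsto.mul_const _ (tendsto_const_nhds.congr' ?_)
    filter_upwards [eventually_zone_ne_zero N] with K hK
    rw [h, div_self (Finset.prod_ne_zero_iff.2 fun i _ => hK i)]
  · by_cases hz : d I = 0
    · simp [hz]
    · exact (tendsto_prod_div_initialSet hm (hd I hz) h).mul_const _

theorem exists_dual_ne_zero {V : Type*} [AddCommGroup V] [Module ℂ V] {v w : V} (hv : v ≠ 0)
    (hw : w ≠ 0) : ∃ φ : V →ₗ[ℂ] ℂ, φ v ≠ 0 ∧ φ w ≠ 0 := by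
  obtain ⟨f, hf⟩ := Module.exists_dual_forall_apply_ne_zero (K := ℂ) (v := (![v, w] : Fin 2 → V))
    (by intro i; fin_cases i <;> simpa)
  exact ⟨f, hf 0, hf 1⟩

/-- A leading term is unique up to a scalar factor. -/
theorem IsLeadingTerm.mem_span {N : ℕ} {F : (Fin N → ℂ) → UCurrent N} {c c' : UCurrent N}
    (h : IsLeadingTerm F c) (h' : IsLeadingTerm F c') : c' ∈ Submodule.span ℂ {c} := by
  obtain ⟨hc, a, ha⟩ := h
  obtain ⟨hc', a', ha'⟩ := h'
  obtain ⟨φ, h1, h2⟩ := exists_dual_ne_zero hc hc'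
  -- Testing both limits with one functional nonzero on `c` and `c'` shows that the ratio of the
  -- normalizing monomials converges. That limit is then the proportionality factor for every
  -- functional.
  have hr : Filter.Tendsto (fun K : Fin N → ℂ => (∏ i, K i ^ a i) / ∏ i, K i ^ a' i) (zone N)
      (nhds (φ c' / φ c)) := by
    refine ((ha' φ).div (ha φ) h1).congr' ?_
    filter_upwards [(ha φ).eventually_ne h1, eventually_zone_ne_zero N] with K hK hK0
    have hF : φ (F K) ≠ 0 := fun h => hK (by simp [h])
    have p1 : ∏ i, K i ^ a i ≠ 0 := Finset.prod_ne_zero_iff.2 fun i _ => pow_ne_zero _ (hK0 i)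
    have p2 : ∏ i, K i ^ a' i ≠ 0 := Finset.prod_ne_zero_iff.2 fun i _ => pow_ne_zero _ (hK0 i)
    simp only [Pi.div_apply]
    field_simp
  refine Submodule.mem_span_singleton.2 ⟨φ c' / φ c, ?_⟩
  rw [← sub_eq_zero, ← Module.forall_dual_apply_eq_zero_iff ℂ]
  intro ψ
  rw [map_sub, sub_eq_zero]
  have hl : Filter.Tendsto (fun K : Fin N → ℂ => ψ (F K) / ∏ i, K i ^ a' i) (zone N)
      (nhds (ψ c * (φ c' / φ c))) := by
    refine ((ha ψ).mul hr).congr' ?_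
    filter_upwards [eventually_zone_ne_zero N] with K hK0
    have p1 : ∏ i, K i ^ a i ≠ 0 := Finset.prod_ne_zero_iff.2 fun i _ => pow_ne_zero _ (hK0 i)
    field_simp
  rw [map_smul, smul_eq_mul, mul_comm]
  exact tendsto_nhds_unique hl (ha' ψ)

/-- A leading term of a function with values in a subspace lies in the subspace. -/
theorem IsLeadingTerm.mem_of_forall_mem {N : ℕ} {F : (Fin N → ℂ) → UCurrent N} {c : UCurrent N}
    (h : IsLeadingTerm F c) (W : Submodule ℂ (UCurrent N)) (hW : ∀ K, F K ∈ W) : c ∈ W := by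
  by_contra hc
  obtain ⟨φ, hφ, hφW⟩ := Submodule.exists_le_ker_of_notMem hc
  obtain ⟨-, a, ha⟩ := h
  refine hφ (tendsto_nhds_unique (ha φ) ?_)
  simp [LinearMap.mem_ker.1 (hφW (hW _))]

/-! ### Diagonal currents and the generators of the limiting algebra -/

theorem currentAction_apply (N n : ℕ) (A : Current N) :
    currentAction N n A = ∑ s : Fin n, slot s A := by
  change (∑ s : Fin n, slot s : Current N →ₗ[ℂ] Module.End ℂ (PolySpace N n)) A = _
  rw [LinearMap.sum_apply]

theorem uAction_uBasis_diag {N n : ℕ} (i : Fin N) (r : ℕ) (f : PolySpace N n)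
    (w : Fin n → Fin N) :
    uAction N n (uBasis i i r) f w = (∑ s ∈ block w i, MvPolynomial.X s ^ r) * f w := by
  have h : uAction N n (uBasis i i r) = currentAction N n (currentBasis i i r) :=
    UniversalEnvelopingAlgebra.lift_ι_apply ℂ _ _
  rw [h, currentAction_apply, LinearMap.sum_apply, Finset.sum_apply, block, Finset.sum_filter,
    Finset.sum_mul]
  refine Finset.sum_congr rfl fun s _ => ?_
  rw [slot_apply]
  by_cases hs : w s = i
  · rw [Finset.sum_eq_single i]
    · subst hs
      simp [currentBasis]
    · intro k _ hk
      simp [currentBasis, hk.symm]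
    · simp
  · simp [currentBasis, Ne.symm hs, hs]

/-- Leading terms must be nonzero. For `n = 1` the sum acts on `v_b`, `b ∈ I`, by `z^r`. -/
theorem sum_uBasis_ne_zero {N : ℕ} {I : Finset (Fin N)} (hI : I.Nonempty) (r : ℕ) :
    ∑ a ∈ I, uBasis a a r ≠ 0 := by
  intro h
  obtain ⟨b, hb⟩ := hI
  have h2 := congrArg (fun u => uAction N 1 u (fun _ => 1) (fun _ => b)) h
  simp only [map_sum, LinearMap.sum_apply, Finset.sum_apply, uAction_uBasis_diag, map_zero,
    LinearMap.zero_apply, Pi.zero_apply, block] at h2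
  rw [Finset.sum_eq_single b] at h2
  · simp at h2
  · intro a _ ha
    simp [ha.symm]
  · exact fun h => absurd hb h

theorem isLeadingTerm_betheCoeff {N i : ℕ} (h1 : 1 ≤ i) (hi : i ≤ N) (j : ℕ) :
    IsLeadingTerm (fun K : Fin N → ℂ => betheCoeff K i (j + 1))
      ((-1 : ℂ) ^ i • ∑ a ∈ (initialSet N (i - 1))ᶜ, uBasis a a j) := by
  have hc : (initialSet N (i - 1)).card + 1 = i := by rw [card_initialSet (by omega)]; omega
  simp only [betheCoeff_eq_sum]
  have he := coeff_opCoeff_of_card (j := j) hi hc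
  rw [← he]
  refine isLeadingTerm_of_card_le (m := i - 1) (by omega)
    (fun I => PowerSeries.coeff (j + 1) (opCoeff I (N - i))) (fun I hI => ?_) ?_
  · by_contra h
    exact hI (coeff_opCoeff_of_le_card hi (Nat.succ_ne_zero j) (by omega))
  · rw [he]
    refine smul_ne_zero (pow_ne_zero _ (by simp)) (sum_uBasis_ne_zero ⟨⟨i - 1, by omega⟩, ?_⟩ _)
    simp only [initialSet, Finset.mem_compl, Finset.mem_filter, Finset.mem_univ, true_and]
    omega

theorem betheInf_eq_adjoin (N : ℕ) :
    betheInf N = Algebra.adjoin ℂ (Set.range fun p : Fin N × ℕ => uBasis p.1 p.1 p.2) := by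
  refine le_antisymm (Algebra.adjoin_le ?_) (Algebra.adjoin_le ?_)
  · rintro c ⟨i, j, h1, hi, hc⟩
    rcases j with _ | j
    · have h := hc.mem_of_forall_mem (Submodule.span ℂ {1}) fun K => coeff_zero_universalOp K _
      obtain ⟨a, rfl⟩ := Submodule.mem_span_singleton.1 h
      exact Subalgebra.smul_mem _ (one_mem _) a
    · obtain ⟨a, rfl⟩ := Submodule.mem_span_singleton.1
        ((isLeadingTerm_betheCoeff h1 hi j).mem_span hc)
      refine Subalgebra.smul_mem _ (Subalgebra.smul_mem _ (sum_mem fun b _ => ?_) _) a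
      exact Algebra.subset_adjoin ⟨(b, j), rfl⟩
  · rintro _ ⟨⟨b, r⟩, rfl⟩
    have hs : ∀ m < N, ∑ a ∈ (initialSet N m)ᶜ, uBasis a a r ∈ betheInf N := by
      intro m hm
      have h := isLeadingTerm_betheCoeff (N := N) (i := m + 1) (by omega) (by omega) r
      have hmem : (-1 : ℂ) ^ (m + 1) • ∑ a ∈ (initialSet N m)ᶜ, uBasis a a r ∈ betheInf N :=
        Algebra.subset_adjoin ⟨m + 1, r + 1, by omega, by omega, h⟩
      have h2 := Subalgebra.smul_mem _ hmem ((-1 : ℂ) ^ (m + 1))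
      rwa [smul_smul, ← mul_pow, neg_one_mul, neg_neg, one_pow, one_smul] at h2
    have hs' : ∀ m ≤ N, ∑ a ∈ (initialSet N m)ᶜ, uBasis a a r ∈ betheInf N := by
      intro m hm
      rcases hm.lt_or_eq with h | rfl
      · exact hs m h
      · simp [initialSet]
    -- Consecutive tails differ by the single index `b`, so subtracting their sums leaves one
    -- current.
    have hd : (initialSet N b)ᶜ = insert b (initialSet N (b + 1))ᶜ := by
      ext a
      simp only [initialSet, Finset.mem_compl, Finset.mem_filter, Finset.mem_univ, true_and,
        Finset.mem_insert, Fin.ext_iff]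
      omega
    have h := sub_mem (hs' b b.2.le) (hs' (b + 1) b.2)
    rwa [hd, Finset.sum_insert (by simp [initialSet]), add_sub_cancel_right] at h

end FlagBethe
end
noncomputable section
namespace FlagBethe

/-! ### Polynomials invariant under colour-preserving permutations -/

section Colour

open Classical in
/-- The power sum of the elements of a given colour. -/
def colourPsum {ι C A : Type*} [Fintype ι] [CommRing A] (c : ι → C) (x : ι → A) (a : C) (r : ℕ) :
    A :=
  ∑ i : ι, if c i = a then x i ^ r else 0

open Classical in
-- Induction on the length. Letting the first entry run freely multiplies the shorter sum by a power
-- sum. The excess consists of tuples whose first entry equals the `l`-th remaining one, which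
-- forces equal colours and adds the exponents; these are again sums over shorter injective tuples.
theorem sum_injective_mem_adjoin {ι C A : Type*} [Fintype ι] [CommRing A] [Algebra ℂ A]
    (c : ι → C) (x : ι → A) : ∀ (m : ℕ) (a : Fin m → C) (r : Fin m → ℕ),
    (∑ g : Fin m → ι, if Function.Injective g ∧ ∀ k, c (g k) = a k then ∏ k, x (g k) ^ r k else 0) ∈
      Algebra.adjoin ℂ (Set.range fun q : C × ℕ => colourPsum c x q.1 q.2)
  | 0, a, r => by
    have : (∑ g : Fin 0 → ι, if Function.Injective g ∧ ∀ k, c (g k) = a k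
        then ∏ k, x (g k) ^ r k else 0) = 1 := by
      rw [Fintype.sum_unique, if_pos ⟨Function.injective_of_subsingleton _, fun k => k.elim0⟩]
      simp
    rw [this]
    exact one_mem _
  | m + 1, a, r => by
    have key : (∑ g : Fin (m + 1) → ι, if Function.Injective g ∧ ∀ k, c (g k) = a k
          then ∏ k, x (g k) ^ r k else 0) =
        (∑ g : Fin m → ι, if Function.Injective g ∧ ∀ k, c (g k) = a k.succ
          then ∏ k, x (g k) ^ r k.succ else 0) * colourPsum c x (a 0) (r 0) -
        ∑ l : Fin m, if a l.succ = a 0 then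
          (∑ g : Fin m → ι, if Function.Injective g ∧ ∀ k, c (g k) = a k.succ
            then ∏ k, x (g k) ^ (r k.succ + Pi.single (M := fun _ => ℕ) l (r 0) k) else 0)
          else 0 := by
      rw [← (Fin.consEquiv fun _ => ι).sum_comp, Fintype.sum_prod_type, Finset.sum_comm,
        Finset.sum_mul]
      have hc : ∀ l : Fin m, (if a l.succ = a 0 then
          (∑ g : Fin m → ι, if Function.Injective g ∧ ∀ k, c (g k) = a k.succ
            then ∏ k, x (g k) ^ (r k.succ + Pi.single (M := fun _ => ℕ) l (r 0) k) else 0)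
          else 0) = ∑ g : Fin m → ι, if a l.succ = a 0 then
          (if Function.Injective g ∧ ∀ k, c (g k) = a k.succ
            then ∏ k, x (g k) ^ (r k.succ + Pi.single (M := fun _ => ℕ) l (r 0) k) else 0)
          else 0 := fun l => by
        split_ifs <;> simp
      rw [Finset.sum_congr rfl fun l _ => hc l, Finset.sum_comm (t := Finset.univ (α := Fin m → ι)),
        ← Finset.sum_sub_distrib]
      refine Finset.sum_congr rfl fun g _ => ?_
      by_cases hg : Function.Injective g ∧ ∀ k, c (g k) = a k.succ
      · simp only [if_pos hg, Fin.consEquiv_apply]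
        have hprod : ∀ l, ∏ k, x (g k) ^ (r k.succ + Pi.single (M := fun _ => ℕ) l (r 0) k) =
            (∏ k, x (g k) ^ r k.succ) * x (g l) ^ r 0 := fun l => by
          simp only [pow_add, Finset.prod_mul_distrib]
          congr 1
          rw [Finset.prod_eq_single l]
          · simp
          · intro k _ hk
            simp [Pi.single_eq_of_ne hk]
          · simp
        -- For a fixed injective tail `g`, the admissible heads are all those of the right colour
        -- except the values of `g`.
        have hsplit : ∀ y, (if Function.Injective (Fin.cons y g : Fin (m + 1) → ι) ∧
            ∀ k, c ((Fin.cons y g : Fin (m + 1) → ι) k) = a k then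
              ∏ k, x ((Fin.cons y g : Fin (m + 1) → ι) k) ^ r k else 0) =
            (∏ k, x (g k) ^ r k.succ) * ((if c y = a 0 then x y ^ r 0 else 0) -
              if y ∈ Finset.univ.image g then (if c y = a 0 then x y ^ r 0 else 0) else 0) := by
          intro y
          by_cases h1 : y ∈ Set.range g
          · have h2 : y ∈ Finset.univ.image g := by simpa using h1
            rw [if_neg (fun h => (Fin.cons_injective_iff.1 h.1).1 h1), if_pos h2, sub_self, mul_zero]
          · have h2 : y ∉ Finset.univ.image g := by simpa using h1
            rw [if_neg h2, sub_zero]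
            by_cases h3 : c y = a 0
            · rw [if_pos ⟨Fin.cons_injective_iff.2 ⟨h1, hg.1⟩, Fin.forall_fin_succ.2 ⟨h3, hg.2⟩⟩,
                if_pos h3, Fin.prod_univ_succ, mul_comm]
              simp only [Fin.cons_zero, Fin.cons_succ]
            · rw [if_neg (fun h => h3 (h.2 0)), if_neg h3, mul_zero]
        refine (Finset.sum_congr rfl fun y _ => hsplit y).trans ?_
        rw [← Finset.mul_sum, Finset.sum_sub_distrib, mul_sub, Finset.sum_ite_mem,
          Finset.univ_inter, Finset.sum_image (fun _ _ _ _ h => hg.1 h), Finset.mul_sum (f := fun l =>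
            if c (g l) = a 0 then x (g l) ^ r 0 else 0)]
        congr 1
        refine Finset.sum_congr rfl fun l _ => ?_
        rw [hprod, hg.2 l, mul_ite, mul_zero]
      · have h1 : ∀ y, ¬ (Function.Injective (Fin.cons y g : Fin (m + 1) → ι) ∧
            ∀ k, c ((Fin.cons y g : Fin (m + 1) → ι) k) = a k) := fun y h => by
          rw [Fin.cons_injective_iff, Fin.forall_fin_succ] at h
          exact hg ⟨h.1.2, h.2.2⟩
        refine (Finset.sum_eq_zero fun y _ => if_neg (h1 y)).trans ?_
        simp [hg]
    rw [key]
    refine sub_mem (mul_mem (sum_injective_mem_adjoin c x m _ _)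
      (Algebra.subset_adjoin ⟨(a 0, r 0), rfl⟩)) (sum_mem fun l _ => ?_)
    split_ifs
    · exact sum_injective_mem_adjoin c x m _ _
    · exact zero_mem _

open Classical in
-- For a monomial, an enumeration of the variables identifies permutations with injective tuples of
-- full length.
theorem sum_rename_mem_adjoin {ι C : Type*} [Fintype ι] (c : ι → C) (p : MvPolynomial ι ℂ) :
    ∑ σ : Equiv.Perm ι with ∀ i, c (σ i) = c i, MvPolynomial.rename σ p ∈
      Algebra.adjoin ℂ (Set.range fun q : C × ℕ =>
        colourPsum c (MvPolynomial.X : ι → MvPolynomial ι ℂ) q.1 q.2) := by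
  induction p using MvPolynomial.induction_on' with
  | add p q hp hq =>
    simp only [map_add, Finset.sum_add_distrib]
    exact add_mem hp hq
  | monomial α b =>
    let e := (Fintype.equivFin ι).symm
    have h := sum_injective_mem_adjoin c (MvPolynomial.X : ι → MvPolynomial ι ℂ) (Fintype.card ι)
      (fun k => c (e k)) (fun k => α (e k))
    have hb := Subalgebra.smul_mem _ h b
    convert hb using 1
    rw [Finset.smul_sum, ← Finset.sum_filter_of_ne (p := fun g : Fin (Fintype.card ι) → ι =>
      Function.Injective g ∧ ∀ k, c (g k) = c (e k))]
    · refine Finset.sum_bij (fun σ _ => σ ∘ e) ?_ ?_ ?_ ?_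
      · intro σ hσ
        simp only [Finset.mem_filter, Finset.mem_univ, true_and] at hσ ⊢
        exact ⟨σ.injective.comp e.injective, fun k => hσ _⟩
      · intro σ _ τ _ hστ
        ext i
        simpa using congrFun hστ (e.symm i)
      · intro g hg
        simp only [Finset.mem_filter, Finset.mem_univ, true_and] at hg
        have hbij : Function.Bijective (g ∘ e.symm) :=
          Finite.injective_iff_bijective.1 (hg.1.comp e.symm.injective)
        refine ⟨Equiv.ofBijective _ hbij, ?_, ?_⟩
        · simp only [Finset.mem_filter, Finset.mem_univ, true_and]
          intro i
          simpa using hg.2 (e.symm i)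
        · funext k
          simp
      · intro σ hσ
        simp only [Finset.mem_filter, Finset.mem_univ, true_and] at hσ
        rw [if_pos ⟨σ.injective.comp e.injective, fun k => hσ _⟩, MvPolynomial.rename_monomial,
          MvPolynomial.monomial_eq, MvPolynomial.smul_eq_C_mul,
          Finsupp.prod_mapDomain_index_inj σ.injective, Finsupp.prod_fintype _ _ (by simp)]
        congr 1
        exact (e.prod_comp fun i => MvPolynomial.X (R := ℂ) (σ i) ^ α i).symm
    · intro g _ hg
      by_contra h
      rw [if_neg h, smul_zero] at hg
      exact hg rfl

open Classical in
-- Averaging over the group of colour-preserving permutations, possible in characteristic zero,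
-- reproduces `p`.
theorem mem_adjoin_colourPsum {ι C : Type*} [Fintype ι] (c : ι → C) (p : MvPolynomial ι ℂ)
    (hp : ∀ σ : Equiv.Perm ι, (∀ i, c (σ i) = c i) → MvPolynomial.rename σ p = p) :
    p ∈ Algebra.adjoin ℂ (Set.range fun q : C × ℕ =>
        colourPsum c (MvPolynomial.X : ι → MvPolynomial ι ℂ) q.1 q.2) := by
  have h := sum_rename_mem_adjoin c p
  rw [Finset.sum_congr rfl fun σ hσ => hp σ (Finset.mem_filter.1 hσ).2, Finset.sum_const,
    ← Nat.cast_smul_eq_nsmul ℂ] at h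
  have hne : ((Finset.univ.filter fun σ : Equiv.Perm ι => ∀ i, c (σ i) = c i).card : ℂ) ≠ 0 :=
    Nat.cast_ne_zero.2 (Finset.card_ne_zero.2 ⟨1, by simp⟩)
  have h2 := Subalgebra.smul_mem _ h
    ((Finset.univ.filter fun σ : Equiv.Perm ι => ∀ i, c (σ i) = c i).card : ℂ)⁻¹
  rwa [inv_smul_smul₀ hne] at h2

end Colour
end FlagBethe
end
noncomputable section
namespace FlagBethe

/-! ### Generators of the cohomology algebra -/

theorem map_psum_newton {σ A : Type*} [Fintype σ] [CommRing A] [Algebra ℂ A]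
    (f : MvPolynomial.symmetricSubalgebra σ ℂ →ₐ[ℂ] A) {k : ℕ} (hk : 0 < k) :
    f ⟨MvPolynomial.psum σ ℂ k, MvPolynomial.psum_isSymmetric σ ℂ k⟩ =
      (-1) ^ (k + 1) * k * f ⟨MvPolynomial.esymm σ ℂ k, MvPolynomial.esymm_isSymmetric σ ℂ k⟩ -
      ∑ a ∈ Finset.HasAntidiagonal.antidiagonal k with a.1 ∈ Set.Ioo 0 k, (-1) ^ a.1 *
        f ⟨MvPolynomial.esymm σ ℂ a.1, MvPolynomial.esymm_isSymmetric σ ℂ a.1⟩ *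
        f ⟨MvPolynomial.psum σ ℂ a.2, MvPolynomial.psum_isSymmetric σ ℂ a.2⟩ := by
  have h : (⟨MvPolynomial.psum σ ℂ k, MvPolynomial.psum_isSymmetric σ ℂ k⟩ :
      MvPolynomial.symmetricSubalgebra σ ℂ) =
      (-1) ^ (k + 1) * k * ⟨MvPolynomial.esymm σ ℂ k, MvPolynomial.esymm_isSymmetric σ ℂ k⟩ -
      ∑ a ∈ Finset.HasAntidiagonal.antidiagonal k with a.1 ∈ Set.Ioo 0 k, (-1) ^ a.1 *
        ⟨MvPolynomial.esymm σ ℂ a.1, MvPolynomial.esymm_isSymmetric σ ℂ a.1⟩ *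
        ⟨MvPolynomial.psum σ ℂ a.2, MvPolynomial.psum_isSymmetric σ ℂ a.2⟩ := by
    refine Subtype.ext ?_
    push_cast
    exact MvPolynomial.psum_eq_mul_esymm_sub_sum σ ℂ k hk
  rw [h]
  simp only [map_sub, map_mul, map_pow, map_neg, map_one, map_natCast, map_sum]

/-- Newton's identities express positive power sums through elementary ones independently of the
number of variables. The case `k = 0` is excluded because it counts the variables. -/
theorem map_psum_eq_of_map_esymm_eq {σ τ A : Type*} [Fintype σ] [Fintype τ] [CommRing A]
    [Algebra ℂ A] (f : MvPolynomial.symmetricSubalgebra σ ℂ →ₐ[ℂ] A)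
    (g : MvPolynomial.symmetricSubalgebra τ ℂ →ₐ[ℂ] A)
    (h : ∀ k, f ⟨MvPolynomial.esymm σ ℂ k, MvPolynomial.esymm_isSymmetric σ ℂ k⟩ =
      g ⟨MvPolynomial.esymm τ ℂ k, MvPolynomial.esymm_isSymmetric τ ℂ k⟩) {k : ℕ} (hk : 0 < k) :
    f ⟨MvPolynomial.psum σ ℂ k, MvPolynomial.psum_isSymmetric σ ℂ k⟩ =
      g ⟨MvPolynomial.psum τ ℂ k, MvPolynomial.psum_isSymmetric τ ℂ k⟩ := by
  induction k using Nat.strong_induction_on with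
  | _ k ih =>
    rw [map_psum_newton f hk, map_psum_newton g hk, h k]
    congr 1
    refine Finset.sum_congr rfl fun a ha => ?_
    simp only [Finset.mem_filter, Finset.HasAntidiagonal.mem_antidiagonal, Set.mem_Ioo] at ha
    rw [h, ih a.2 (by omega) (by omega)]

theorem coeff_prod_one_add {σ R : Type*} [Fintype σ] [CommRing R] (x : σ → R) (k : ℕ) :
    (∏ i, (1 + Polynomial.X * Polynomial.C (x i))).coeff k =
      ∑ t ∈ Finset.powersetCard k Finset.univ, ∏ i ∈ t, x i := by
  classical
  rw [Finset.prod_one_add, Polynomial.finsetSum_coeff,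
    ← Finset.sum_filter_of_ne (p := fun t : Finset σ => t.card = k)]
  · refine Finset.sum_congr ?_ fun t ht => ?_
    · ext t; simp [Finset.mem_powersetCard]
    · rw [Finset.mem_powersetCard] at ht
      rw [Finset.prod_mul_distrib, Finset.prod_const, ht.2, ← map_prod, mul_comm,
        Polynomial.coeff_C_mul, Polynomial.coeff_X_pow, if_pos rfl, mul_one]
  · intro t _ ht
    by_contra h
    rw [Finset.prod_mul_distrib, Finset.prod_const, ← map_prod, mul_comm,
        Polynomial.coeff_C_mul, Polynomial.coeff_X_pow, if_neg (Ne.symm h), mul_zero] at ht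
    exact ht rfl

theorem rename_esymm {σ τ : Type*} [Fintype σ] (f : σ → τ) (k : ℕ) :
    MvPolynomial.rename f (MvPolynomial.esymm σ ℂ k) =
      (∏ i, (1 + Polynomial.X * Polynomial.C (MvPolynomial.X (f i) : MvPolynomial τ ℂ))).coeff k := by
  rw [coeff_prod_one_add, MvPolynomial.esymm, map_sum]
  refine Finset.sum_congr rfl fun t _ => ?_
  rw [map_prod]
  simp

section

variable {N : ℕ} (n : ℕ) (lam : Fin N → ℕ)

/-- Symmetric polynomials in the variables `z_s`, as elements of the cohomology algebra. -/
def symmZ : MvPolynomial.symmetricSubalgebra (Fin n) ℂ →ₐ[ℂ] EqCohomology n lam :=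
  (Ideal.Quotient.mkₐ ℂ (relIdeal n lam)).comp
    (((MvPolynomial.rename Sum.inl).comp
      (MvPolynomial.symmetricSubalgebra (Fin n) ℂ).val).codRestrict (rootInvariants n lam)
      fun p σ τ => by
        simp only [AlgHom.comp_apply, MvPolynomial.rename_rename]
        change MvPolynomial.rename (Sum.inl ∘ σ) _ = _
        rw [← MvPolynomial.rename_rename]
        congr 1
        exact p.2 σ)

/-- Symmetric polynomials in all variables `γ_{ij}`, as elements of the cohomology algebra. -/
def symmGamma : MvPolynomial.symmetricSubalgebra (Σ i : Fin N, Fin (lam i)) ℂ →ₐ[ℂ]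
    EqCohomology n lam :=
  (Ideal.Quotient.mkₐ ℂ (relIdeal n lam)).comp
    (((MvPolynomial.rename Sum.inr).comp
      (MvPolynomial.symmetricSubalgebra (Σ i : Fin N, Fin (lam i)) ℂ).val).codRestrict
      (rootInvariants n lam)
      fun p σ τ => by
        simp only [AlgHom.comp_apply, MvPolynomial.rename_rename]
        change MvPolynomial.rename (Sum.inr ∘ Equiv.sigmaCongrRight τ) _ = _
        rw [← MvPolynomial.rename_rename]
        congr 1
        exact p.2 (Equiv.sigmaCongrRight τ))

theorem symmZ_esymm (k : ℕ) :
    symmZ n lam ⟨MvPolynomial.esymm _ ℂ k, MvPolynomial.esymm_isSymmetric _ ℂ k⟩ =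
      symmGamma n lam ⟨MvPolynomial.esymm _ ℂ k, MvPolynomial.esymm_isSymmetric _ ℂ k⟩ := by
  symm
  refine (Ideal.Quotient.mk_eq_mk_iff_sub_mem _ _).2 (Ideal.subset_span ⟨k, ?_⟩)
  have h : ∏ i : Fin N, ∏ j : Fin (lam i),
        (1 + Polynomial.X * Polynomial.C (gammaVar n lam i j)) =
      ∏ p : Σ i : Fin N, Fin (lam i),
        (1 + Polynomial.X * Polynomial.C (MvPolynomial.X (Sum.inr p) : RootPoly n lam)) := by
    rw [Fintype.prod_sigma]
    rfl
  rw [h, Polynomial.coeff_sub, ← rename_esymm]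
  exact congrArg (_ - ·) (rename_esymm _ k)

theorem zPsum_mem (r : ℕ) : ∑ s : Fin n, zVar lam s ^ r ∈ rootInvariants n lam := by
  intro σ τ
  simp only [zVar, map_sum, map_pow, MvPolynomial.rename_X, Sum.map_inl]
  exact Equiv.sum_comp σ (fun s => (MvPolynomial.X (Sum.inl s) : RootPoly n lam) ^ r)

theorem mk_zPsum (hlam : ∑ i, lam i = n) (r : ℕ) :
    Ideal.Quotient.mk (relIdeal n lam) ⟨∑ s : Fin n, zVar lam s ^ r, zPsum_mem n lam r⟩ =
      ∑ i, powerSumClass n lam i r := by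
  -- Power sums of degree zero count the variables, so here `∑ λ_i = n` is needed; positive degrees
  -- follow from the relations.
  rcases Nat.eq_zero_or_pos r with rfl | hr
  · unfold powerSumClass
    rw [← map_sum]
    congr 1
    refine Subtype.ext ?_
    rw [AddSubmonoidClass.coe_finsetSum]
    simp [← hlam]
  · have h := map_psum_eq_of_map_esymm_eq (A := EqCohomology n lam)
      (symmZ n lam) (symmGamma n lam) (symmZ_esymm n lam) hr
    refine Eq.trans ?_ (h.trans ?_)
    · refine congrArg (Ideal.Quotient.mk (relIdeal n lam)) (Subtype.ext ?_)
      change _ = MvPolynomial.rename _ (MvPolynomial.psum _ ℂ r)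
      simp [MvPolynomial.psum, zVar]
    · unfold powerSumClass
      rw [← map_sum]
      refine congrArg (Ideal.Quotient.mk (relIdeal n lam)) (Subtype.ext ?_)
      change MvPolynomial.rename _ (MvPolynomial.psum _ ℂ r) = _
      rw [AddSubmonoidClass.coe_finsetSum]
      simp [MvPolynomial.psum, gammaVar, Fintype.sum_sigma]

/-- The kind of a variable: `none` for the `z_s`, and `some i` for the `γ_{ij}`. -/
def varColour : Fin n ⊕ (Σ i : Fin N, Fin (lam i)) → Option (Fin N) :=
  Sum.elim (fun _ => none) fun p => some p.1

theorem exists_eq_map_of_varColour (σ : Equiv.Perm (Fin n ⊕ (Σ i : Fin N, Fin (lam i))))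
    (h : ∀ x, varColour n lam (σ x) = varColour n lam x) :
    ∃ (σ' : Equiv.Perm (Fin n)) (τ : ∀ i : Fin N, Equiv.Perm (Fin (lam i))),
      ⇑σ = Sum.map σ' (Sigma.map id fun i => τ i) := by
  have h1 : ∀ s : Fin n, ∃ s' : Fin n, σ (Sum.inl s) = Sum.inl s' := by
    intro s
    have := h (Sum.inl s)
    rcases hx : σ (Sum.inl s) with s' | p
    · exact ⟨s', rfl⟩
    · rw [hx] at this; simp [varColour] at this
  have h2 : ∀ (i : Fin N) (j : Fin (lam i)), ∃ j' : Fin (lam i),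
      σ (Sum.inr ⟨i, j⟩) = Sum.inr ⟨i, j'⟩ := by
    intro i j
    have := h (Sum.inr ⟨i, j⟩)
    rcases hx : σ (Sum.inr ⟨i, j⟩) with s' | ⟨i', j'⟩
    · rw [hx] at this; simp [varColour] at this
    · rw [hx] at this
      simp only [varColour, Sum.elim_inr, Option.some.injEq] at this
      subst this
      exact ⟨j', rfl⟩
  choose f hf using h1
  choose g hg using h2
  have hfb : Function.Bijective f := Finite.injective_iff_bijective.1 fun a b hab => by
    have : σ (Sum.inl a) = σ (Sum.inl b) := by rw [hf, hf, hab]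
    simpa using this
  have hgb : ∀ i, Function.Bijective (g i) := fun i =>
    Finite.injective_iff_bijective.1 fun a b hab => by
      have : σ (Sum.inr ⟨i, a⟩) = σ (Sum.inr ⟨i, b⟩) := by rw [hg, hg, hab]
      simpa using this
  refine ⟨Equiv.ofBijective f hfb, fun i => Equiv.ofBijective (g i) (hgb i), ?_⟩
  funext x
  rcases x with s | ⟨i, j⟩
  · simp [hf]
  · simp [hg, Sigma.map]

/-- The group defining `rootInvariants` consists of the permutations preserving `varColour`, so
invariants are polynomials in power sums of the `z_s` and of each family of `γ_{ij}`. In the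
quotient the former are sums of the latter. -/
theorem adjoin_powerSumClass (hlam : ∑ i, lam i = n) :
    Algebra.adjoin ℂ (Set.range fun p : Fin N × ℕ => powerSumClass n lam p.1 p.2) = ⊤ := by
  refine eq_top_iff.2 fun y _ => ?_
  obtain ⟨x, rfl⟩ := Ideal.Quotient.mk_surjective y
  have hx := mem_adjoin_colourPsum (varColour n lam) (x : RootPoly n lam) fun σ hσ => by
    obtain ⟨σ', τ, h⟩ := exists_eq_map_of_varColour n lam σ hσ
    rw [h]
    exact x.2 σ' τ
  have hle : Algebra.adjoin ℂ (Set.range fun q : Option (Fin N) × ℕ =>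
      colourPsum (varColour n lam) (MvPolynomial.X : _ → RootPoly n lam) q.1 q.2) ≤
      ((Algebra.adjoin ℂ (Set.range fun p : Fin N × ℕ => powerSumClass n lam p.1 p.2)).comap
        (Ideal.Quotient.mkₐ ℂ (relIdeal n lam))).map (rootInvariants n lam).val := by
    refine Algebra.adjoin_le ?_
    rintro _ ⟨⟨a, r⟩, rfl⟩
    rcases a with _ | i
    · refine ⟨⟨_, zPsum_mem n lam r⟩, ?_, ?_⟩
      · change Ideal.Quotient.mk (relIdeal n lam) _ ∈ Algebra.adjoin ℂ
          (Set.range fun p : Fin N × ℕ => powerSumClass n lam p.1 p.2)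
        rw [mk_zPsum n lam hlam]
        exact sum_mem fun i _ => Algebra.subset_adjoin ⟨(i, r), rfl⟩
      · simp [colourPsum, varColour, zVar]
    · refine ⟨⟨_, powerSum_mem n lam i r⟩, ?_, ?_⟩
      · exact Algebra.subset_adjoin ⟨(i, r), rfl⟩
      · simp only [colourPsum, varColour, Fintype.sum_sum_type, Sum.elim_inl, reduceCtorEq,
          if_false, Finset.sum_const_zero, zero_add, Sum.elim_inr, Option.some.injEq]
        rw [Fintype.sum_sigma, Finset.sum_eq_single i]
        · simp [gammaVar]
        · intro k _ hk
          simp [hk]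
        · simp
  obtain ⟨x', h1, h2⟩ := hle hx
  obtain rfl : x' = x := Subtype.ext h2
  exact h1

theorem exists_gamma_rep (hlam : ∑ i, lam i = n) (h : EqCohomology n lam) :
    ∃ (q : MvPolynomial (Σ i : Fin N, Fin (lam i)) ℂ)
      (hq : MvPolynomial.rename Sum.inr q ∈ rootInvariants n lam),
      Ideal.Quotient.mk (relIdeal n lam) ⟨MvPolynomial.rename Sum.inr q, hq⟩ = h := by
  have hle : Algebra.adjoin ℂ (Set.range fun p : Fin N × ℕ => powerSumClass n lam p.1 p.2) ≤
      ((MvPolynomial.rename (R := ℂ) (Sum.inr :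
        (Σ i : Fin N, Fin (lam i)) → Fin n ⊕ (Σ i : Fin N, Fin (lam i)))).range.comap
        (rootInvariants n lam).val).map (Ideal.Quotient.mkₐ ℂ (relIdeal n lam)) := by
    refine Algebra.adjoin_le ?_
    rintro _ ⟨⟨i, r⟩, rfl⟩
    refine ⟨⟨_, powerSum_mem n lam i r⟩,
      ⟨∑ j : Fin (lam i), MvPolynomial.X ⟨i, j⟩ ^ r, ?_⟩, rfl⟩
    change MvPolynomial.rename Sum.inr _ = ∑ j : Fin (lam i), gammaVar n lam i j ^ r
    simp [gammaVar]
  rw [adjoin_powerSumClass n lam hlam] at hle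
  obtain ⟨x, ⟨q, hq⟩, hx⟩ := hle (Algebra.mem_top (x := h))
  replace hq : MvPolynomial.rename Sum.inr q = (x : RootPoly n lam) := hq
  refine ⟨q, hq ▸ x.2, Eq.trans ?_ hx⟩
  exact congrArg (Ideal.Quotient.mk (relIdeal n lam)) (Subtype.ext hq)

/-! ### Substitution of a decomposition into a class -/

variable {n}

/-- On a representative in the `γ_{ij}` alone the substitution is a renaming, injective because the
blocks are disjoint. -/
theorem substClass_injective (hlam : ∑ i, lam i = n) (w : Fin n → Fin N) (hw : IsIndex lam w) :
    Function.Injective (substClass lam w hw) := by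
  rw [injective_iff_map_eq_zero]
  intro h h0
  obtain ⟨q, hq, rfl⟩ := exists_gamma_rep n lam hlam h
  have h1 : substClass lam w hw (Ideal.Quotient.mk (relIdeal n lam)
      ⟨MvPolynomial.rename Sum.inr q, hq⟩) = MvPolynomial.rename
        (fun p : Σ i : Fin N, Fin (lam i) => (block w p.1).orderEmbOfFin (hw p.1) p.2) q := by
    change substPoly lam w hw (MvPolynomial.rename Sum.inr q) = _
    rw [substPoly, MvPolynomial.aeval_rename]
    refine DFunLike.congr_fun (?_ : MvPolynomial.aeval _ = MvPolynomial.rename _) q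
    refine MvPolynomial.algHom_ext fun p => ?_
    rw [MvPolynomial.aeval_X, MvPolynomial.rename_X]
    rfl
  have hinj : Function.Injective
      (fun p : Σ i : Fin N, Fin (lam i) => (block w p.1).orderEmbOfFin (hw p.1) p.2) := by
    rintro ⟨i, j⟩ ⟨i', j'⟩ h
    simp only at h
    have hm := fun (i : Fin N) (j : Fin (lam i)) =>
      (Finset.mem_filter.1 (Finset.orderEmbOfFin_mem (block w i) (hw i) j)).2
    obtain rfl : i = i' := by rw [← hm i j, h, hm]
    rw [((block w i).orderEmbOfFin (hw i)).injective h]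
  rw [h1] at h0
  obtain rfl : q = 0 := MvPolynomial.rename_injective _ hinj (by rw [h0, map_zero])
  refine (congrArg (Ideal.Quotient.mk (relIdeal n lam)) (Subtype.ext ?_)).trans (map_zero _)
  simp

theorem substClass_powerSumClass (w : Fin n → Fin N) (hw : IsIndex lam w) (i : Fin N) (r : ℕ) :
    substClass lam w hw (powerSumClass n lam i r) = ∑ s ∈ block w i, MvPolynomial.X s ^ r := by
  change substPoly lam w hw (∑ j : Fin (lam i), gammaVar n lam i j ^ r) = _
  conv_rhs => rw [← Finset.map_orderEmbOfFin_univ (block w i) (hw i), Finset.sum_map]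
  simp [substPoly, gammaVar]

theorem block_comp (w : Fin n → Fin N) (σ : Equiv.Perm (Fin n)) (i : Fin N) :
    (block (w ∘ σ) i).map σ.toEmbedding = block w i := by
  ext s
  simp only [block, Finset.mem_map_equiv, Finset.mem_filter, Finset.mem_univ, true_and,
    Function.comp_apply, Equiv.apply_symm_apply]

theorem IsIndex.comp {lam : Fin N → ℕ} {w : Fin n → Fin N} (hw : IsIndex lam w)
    (σ : Equiv.Perm (Fin n)) : IsIndex lam (w ∘ σ) := fun i => by
  rw [← hw i, ← block_comp w σ i, Finset.card_map]

/-- The increasing enumeration of blocks is not compatible with `σ`, but power sums do not see it,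
and they generate. -/
theorem rename_substClass_comp (hlam : ∑ i, lam i = n) (w : Fin n → Fin N) (hw : IsIndex lam w)
    (σ : Equiv.Perm (Fin n)) (h : EqCohomology n lam) :
    MvPolynomial.rename σ (substClass lam (w ∘ σ) (hw.comp σ) h) = substClass lam w hw h := by
  have : (MvPolynomial.rename σ).comp (substClass lam (w ∘ σ) (hw.comp σ)) =
      substClass lam w hw := by
    refine AlgHom.ext_of_adjoin_eq_top (adjoin_powerSumClass n lam hlam) ?_
    rintro _ ⟨⟨i, r⟩, rfl⟩
    simp only [AlgHom.comp_apply, substClass_powerSumClass, map_sum, map_pow, MvPolynomial.rename_X]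
    rw [← block_comp w σ i, Finset.sum_map]
    rfl
  exact DFunLike.congr_fun this h

theorem exists_isIndex (hlam : ∑ i, lam i = n) : ∃ w : Fin n → Fin N, IsIndex lam w := by
  have hc : Fintype.card (Σ i : Fin N, Fin (lam i)) = n := by simp [hlam]
  let e : (Σ i : Fin N, Fin (lam i)) ≃ Fin n := Fintype.equivFinOfCardEq hc
  refine ⟨fun s => (e.symm s).1, fun i => ?_⟩
  have : block (fun s => (e.symm s).1) i =
      Finset.univ.map ((Function.Embedding.sigmaMk (β := fun i => Fin (lam i)) i).trans
        e.toEmbedding) := by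
    ext s
    simp only [block, Finset.mem_filter, Finset.mem_univ, true_and, Finset.mem_map,
      Function.Embedding.trans_apply, Function.Embedding.sigmaMk_apply, Equiv.coe_toEmbedding]
    constructor
    · rintro rfl
      exact ⟨(e.symm s).2, by simp⟩
    · rintro ⟨j, rfl⟩
      simp
  rw [this]
  simp

/-- Transitivity of `S_n` on decompositions: bijections between corresponding blocks glue to a
permutation. -/
theorem exists_comp_eq {lam : Fin N → ℕ} {w w' : Fin n → Fin N} (hw : IsIndex lam w)
    (hw' : IsIndex lam w') : ∃ σ : Equiv.Perm (Fin n), w ∘ σ = w' := by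
  have h : ∀ i, Nonempty ({s // w' s = i} ≃ {s // w s = i}) := fun i => by
    refine ⟨Fintype.equivOfCardEq ?_⟩
    rw [Fintype.card_subtype, Fintype.card_subtype]
    exact (hw' i).trans (hw i).symm
  let e := fun i => (h i).some
  refine ⟨(Equiv.sigmaFiberEquiv w').symm.trans
    ((Equiv.sigmaCongrRight e).trans (Equiv.sigmaFiberEquiv w)), ?_⟩
  funext s
  exact (e (w' s) ⟨s, rfl⟩).2

/-- Polynomials invariant under the stabilizer of an index are values of cohomology classes. -/
theorem exists_substClass_eq (w : Fin n → Fin N) (hw : IsIndex lam w)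
    (p : MvPolynomial (Fin n) ℂ)
    (hp : ∀ σ : Equiv.Perm (Fin n), w ∘ σ = w → MvPolynomial.rename σ p = p) :
    ∃ h, substClass lam w hw h = p := by
  have h := mem_adjoin_colourPsum w p fun σ hσ => hp σ (funext hσ)
  have hle : Algebra.adjoin ℂ (Set.range fun q : Fin N × ℕ =>
      colourPsum w (MvPolynomial.X : _ → MvPolynomial (Fin n) ℂ) q.1 q.2) ≤
      (substClass lam w hw).range := by
    refine Algebra.adjoin_le ?_
    rintro _ ⟨⟨i, r⟩, rfl⟩
    refine ⟨powerSumClass n lam i r, (substClass_powerSumClass lam w hw i r).trans ?_⟩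
    rw [block, Finset.sum_filter]
    exact Finset.sum_congr rfl fun s _ => by congr
  exact hle h

end
end FlagBethe
end
noncomputable section
namespace FlagBethe

/-! ### The Bethe algebra of a space carrying the regular representation -/

/-- Shared by both signs. Transport along `e` makes `L` the regular module, on which multiplications
act faithfully. The generators of `H_λ` act as the generators of `betheInf N`, so the two algebras
have the same image in `End L`. -/
theorem exists_betheInfOn_equiv {N n : ℕ} {lam : Fin N → ℕ} (hlam : ∑ i, lam i = n)
    (L : Submodule ℂ (PolySpace N n)) (e : EqCohomology n lam ≃ₗ[ℂ] L)
    (he : ∀ i r h, (e (powerSumClass n lam i r * h) : PolySpace N n) =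
      uAction N n (uBasis i i r) (e h)) :
    (∀ b ∈ betheInf N, ∀ x ∈ L, uAction N n b x ∈ L) ∧
    ∃ ξ : betheInfOn L ≃ₐ[ℂ] EqCohomology n lam,
      (∀ (i : Fin N) (r : ℕ), ∃ b : betheInfOn L,
        ActsAs b.1 (uBasis i i r) ∧ ξ b = powerSumClass n lam i r) ∧
      (∀ ξ' : betheInfOn L →ₐ[ℂ] EqCohomology n lam,
        (∀ (i : Fin N) (r : ℕ) (b : betheInfOn L),
          ActsAs b.1 (uBasis i i r) → ξ' b = powerSumClass n lam i r) →
        ξ' = (ξ : betheInfOn L →ₐ[ℂ] EqCohomology n lam)) ∧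
      ∀ (b : betheInfOn L) (h : EqCohomology n lam), e (ξ b * h) = b.1 (e h) := by
  let Ψ : EqCohomology n lam →ₐ[ℂ] Module.End ℂ L :=
    (e.conjAlgEquiv ℂ).toAlgHom.comp (Algebra.lmul ℂ (EqCohomology n lam))
  have hΨ : ∀ h x, Ψ h x = e (h * e.symm x) := fun h x => rfl
  have hinj : Function.Injective Ψ := fun h h' heq => by
    have h1 := LinearMap.congr_fun heq (e 1)
    rw [hΨ, hΨ, e.symm_apply_apply, mul_one, mul_one] at h1
    exact e.injective h1
  have hP : ∀ i r, ActsAs (Ψ (powerSumClass n lam i r)) (uBasis i i r) := fun i r x => by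
    rw [hΨ, he, e.apply_symm_apply]
  -- Invariance of `L` is a consequence: every `b` acts on `L` as multiplication by some class.
  have hact : ∀ b ∈ betheInf N, ∃ h, ActsAs (Ψ h) b := by
    intro b hb
    rw [betheInf_eq_adjoin] at hb
    induction hb using Algebra.adjoin_induction with
    | mem b hb =>
      obtain ⟨⟨i, r⟩, rfl⟩ := hb
      exact ⟨_, hP i r⟩
    | algebraMap c =>
      refine ⟨algebraMap ℂ _ c, fun x => ?_⟩
      rw [AlgHom.commutes, AlgHom.commutes, Module.algebraMap_end_apply,
        Module.algebraMap_end_apply, Submodule.coe_smul]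
    | add b c _ _ hb hc =>
      obtain ⟨h, hh⟩ := hb
      obtain ⟨k, hk⟩ := hc
      refine ⟨h + k, fun x => ?_⟩
      rw [map_add, map_add, LinearMap.add_apply, LinearMap.add_apply, Submodule.coe_add, hh, hk]
    | mul b c _ _ hb hc =>
      obtain ⟨h, hh⟩ := hb
      obtain ⟨k, hk⟩ := hc
      refine ⟨h * k, fun x => ?_⟩
      rw [map_mul, map_mul, Module.End.mul_apply, Module.End.mul_apply, hh, hk]
  have hext : ∀ {f g : Module.End ℂ L} {b : UCurrent N}, ActsAs f b → ActsAs g b → f = g :=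
    fun hf hg => LinearMap.ext fun x => Subtype.ext ((hf x).trans (hg x).symm)
  have hrange : Ψ.range = betheInfOn L := by
    refine le_antisymm ?_ ?_
    · rw [← Algebra.map_top, ← adjoin_powerSumClass n lam hlam, AlgHom.map_adjoin]
      refine Algebra.adjoin_le ?_
      rintro _ ⟨_, ⟨⟨i, r⟩, rfl⟩, rfl⟩
      refine ⟨uBasis i i r, ?_, hP i r⟩
      rw [betheInf_eq_adjoin]
      exact Algebra.subset_adjoin ⟨(i, r), rfl⟩
    · rintro f ⟨b, hb, hf⟩
      obtain ⟨h, hh⟩ := hact b hb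
      exact ⟨h, hext hh hf⟩
  let ζ : EqCohomology n lam ≃ₐ[ℂ] betheInfOn L :=
    (AlgEquiv.ofInjective Ψ hinj).trans (Subalgebra.equivOfEq _ _ hrange)
  have hζ : ∀ h, (ζ h).1 = Ψ h := fun h => rfl
  refine ⟨fun b hb x hx => ?_, ζ.symm, fun i r => ?_, fun ξ' hξ' => ?_, fun b h => ?_⟩
  · obtain ⟨h, hh⟩ := hact b hb
    rw [← hh ⟨x, hx⟩]
    exact (Ψ h ⟨x, hx⟩).2
  · exact ⟨ζ (powerSumClass n lam i r), hP i r, ζ.symm_apply_apply _⟩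
  · have h1 : ξ'.comp ζ.toAlgHom = AlgHom.id ℂ _ := by
      refine AlgHom.ext_of_adjoin_eq_top (adjoin_powerSumClass n lam hlam) ?_
      rintro _ ⟨⟨i, r⟩, rfl⟩
      exact hξ' i r _ (hP i r)
    refine AlgHom.ext fun b => ?_
    have h2 := DFunLike.congr_fun h1 (ζ.symm b)
    exact (congrArg ξ' (ζ.apply_symm_apply b)).symm.trans h2
  · have h1 : Ψ (ζ.symm b) = b.1 := by rw [← hζ, ζ.apply_symm_apply]
    rw [← h1, hΨ, e.symm_apply_apply]

/-! ### The weight subspaces -/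

section

variable {N n : ℕ} {lam : Fin N → ℕ}

theorem mem_weightSpace {x : PolySpace N n} :
    x ∈ weightSpace n lam ↔ ∀ w, ¬ IsIndex lam w → x w = 0 := by
  have h : x ∈ weightSpace n lam ↔
      ∀ i w, (((block w i).card : MvPolynomial (Fin n) ℂ) - lam i) * x w = 0 := by
    simp only [weightSpace, Submodule.mem_iInf, LinearMap.mem_ker, LinearMap.sub_apply,
      funext_iff, Pi.sub_apply, uAction_uBasis_diag, LinearMap.smul_apply, Pi.smul_apply,
      LinearMap.id_apply, Pi.zero_apply]
    refine forall₂_congr fun i w => ?_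
    simp [sub_mul, MvPolynomial.smul_eq_C_mul]
  rw [h]
  constructor
  · intro h w hw
    rw [IsIndex, not_forall] at hw
    obtain ⟨i, hi⟩ := hw
    refine (mul_eq_zero.1 (h i w)).resolve_left fun h0 => hi ?_
    exact_mod_cast sub_eq_zero.1 h0
  · intro h i w
    by_cases hw : IsIndex lam w
    · simp [hw i]
    · rw [h w hw, mul_zero]

theorem mem_invariants {x : PolySpace N n} :
    x ∈ invariants N n ↔ ∀ (σ : Equiv.Perm (Fin n)) (w : Fin n → Fin N),
      MvPolynomial.rename σ (x (w ∘ σ)) = x w := by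
  simp only [invariants, Submodule.mem_iInf, LinearMap.mem_ker, LinearMap.sub_apply, sub_eq_zero,
    funext_iff, LinearMap.id_apply]
  rfl

theorem mem_antiinvariants {x : PolySpace N n} :
    x ∈ antiinvariants N n ↔ ∀ (σ : Equiv.Perm (Fin n)) (w : Fin n → Fin N),
      MvPolynomial.rename σ (x (w ∘ σ)) = ((Equiv.Perm.sign σ : ℤˣ) : ℤ) • x w := by
  simp only [antiinvariants, Submodule.mem_iInf, LinearMap.mem_ker, LinearMap.sub_apply,
    sub_eq_zero, funext_iff, LinearMap.smul_apply, LinearMap.id_apply]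
  rfl

theorem iPlus_apply (h : EqCohomology n lam) {w : Fin n → Fin N} (hw : IsIndex lam w) :
    iPlus n lam h w = substClass lam w hw h := by
  simp [iPlus, hw]

theorem iPlus_apply_of_not (h : EqCohomology n lam) {w : Fin n → Fin N} (hw : ¬ IsIndex lam w) :
    iPlus n lam h w = 0 := by
  simp [iPlus, hw]

theorem isIndex_comp_iff (w : Fin n → Fin N) (σ : Equiv.Perm (Fin n)) :
    IsIndex lam (w ∘ σ) ↔ IsIndex lam w := by
  refine ⟨fun h => ?_, fun h => h.comp σ⟩
  have := h.comp σ⁻¹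
  rwa [Function.comp_assoc, ← Equiv.Perm.coe_mul, mul_inv_cancel, Equiv.Perm.coe_one,
    Function.comp_id] at this

theorem iPlus_mem (hlam : ∑ i, lam i = n) (h : EqCohomology n lam) :
    iPlus n lam h ∈ VPlus n lam := by
  refine ⟨mem_invariants.2 fun σ w => ?_, mem_weightSpace.2 fun w hw => iPlus_apply_of_not h hw⟩
  by_cases hw : IsIndex lam w
  · rw [iPlus_apply h hw, iPlus_apply h (hw.comp σ), rename_substClass_comp lam hlam]
  · rw [iPlus_apply_of_not h hw, iPlus_apply_of_not h (mt (isIndex_comp_iff w σ).1 hw), map_zero]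

theorem iPlus_injective (hlam : ∑ i, lam i = n) : Function.Injective (iPlus n lam) := by
  obtain ⟨w, hw⟩ := exists_isIndex lam hlam
  intro h h' heq
  have := congrFun heq w
  rw [iPlus_apply h hw, iPlus_apply h' hw] at this
  exact substClass_injective lam hlam w hw this

theorem range_iPlus (hlam : ∑ i, lam i = n) : LinearMap.range (iPlus n lam) = VPlus n lam := by
  refine le_antisymm ?_ ?_
  · rintro _ ⟨h, rfl⟩
    exact iPlus_mem hlam h
  · rintro x ⟨hx, hxw⟩
    obtain ⟨w, hw⟩ := exists_isIndex lam hlam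
    rw [SetLike.mem_coe, mem_invariants] at hx
    -- For `σ` in the stabilizer of `w`, invariance of `x` is invariance of the polynomial `x w`.
    -- Transitivity then settles the other coordinates.
    obtain ⟨h, hh⟩ := exists_substClass_eq lam w hw (x w) fun σ hσ => by
      conv_lhs => rw [← hσ, hx σ w]
    refine ⟨h, funext fun w' => ?_⟩
    by_cases hw' : IsIndex lam w'
    · obtain ⟨σ, rfl⟩ := exists_comp_eq hw' hw
      rw [← hx σ w', ← hh, iPlus_apply h hw', rename_substClass_comp lam hlam]
    · rw [iPlus_apply_of_not h hw', mem_weightSpace.1 hxw w' hw']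

/-! ### Antiinvariants -/

theorem discD_eq_prod (n : ℕ) : discD n = ∏ p : Fin n × Fin n,
    if p.1 < p.2 then (MvPolynomial.X p.2 - MvPolynomial.X p.1) else 1 := by
  rw [Fintype.prod_prod_type]
  refine Finset.prod_congr rfl fun i _ => ?_
  rw [← Finset.prod_filter]
  refine Finset.prod_congr ?_ fun _ _ => rfl
  ext j; simp

theorem blockR_eq_prod (w : Fin n → Fin N) : blockR w = ∏ a : Fin n, ∏ b : Fin n,
    if w a < w b then (MvPolynomial.X b - MvPolynomial.X a : MvPolynomial (Fin n) ℂ) else 1 := by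
  rw [← Finset.prod_fiberwise Finset.univ w]
  refine Finset.prod_congr rfl fun i _ => ?_
  rw [Finset.prod_comm]
  refine Finset.prod_congr rfl fun a ha => ?_
  obtain rfl := (Finset.mem_filter.1 ha).2
  rw [← Finset.prod_fiberwise Finset.univ w]
  have h : Finset.Ioi (w a) = Finset.univ.filter fun j => w a < j := by ext; simp
  rw [h, Finset.prod_filter]
  refine Finset.prod_congr rfl fun j _ => ?_
  have h2 : ∀ b ∈ Finset.univ.filter fun k => w k = j, (if w a < w b then
      (MvPolynomial.X b - MvPolynomial.X a : MvPolynomial (Fin n) ℂ) else 1) =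
      if w a < j then (MvPolynomial.X b - MvPolynomial.X a) else 1 := fun b hb => by
    rw [(Finset.mem_filter.1 hb).2]
  rw [Finset.prod_congr rfl h2]
  split_ifs
  · rfl
  · simp

theorem rename_blockR_comp (w : Fin n → Fin N) (σ : Equiv.Perm (Fin n)) :
    MvPolynomial.rename σ (blockR (w ∘ σ)) = blockR w := by
  rw [blockR_eq_prod, blockR_eq_prod, map_prod]
  conv_rhs => rw [← Equiv.prod_comp σ]
  refine Finset.prod_congr rfl fun a _ => ?_
  rw [map_prod]
  conv_rhs => rw [← Equiv.prod_comp σ]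
  refine Finset.prod_congr rfl fun b _ => ?_
  simp only [Function.comp_apply]
  split_ifs <;> simp

/-- `D` is a Vandermonde determinant, and renaming permutes its rows. -/
theorem rename_discD (σ : Equiv.Perm (Fin n)) :
    MvPolynomial.rename σ (discD n) = ((Equiv.Perm.sign σ : ℤˣ) : ℤ) • discD n := by
  have h : discD n = (Matrix.vandermonde (MvPolynomial.X : Fin n → MvPolynomial (Fin n) ℂ)).det :=
    (Matrix.det_vandermonde _).symm
  rw [h, AlgHom.map_det, zsmul_eq_mul, ← Matrix.det_permute]
  congr 1
  ext1 i j
  simp [Matrix.vandermonde_apply]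

theorem discD_ne_zero (n : ℕ) : discD n ≠ 0 := by
  refine Finset.prod_ne_zero_iff.2 fun i _ => Finset.prod_ne_zero_iff.2 fun j hj => ?_
  rw [sub_ne_zero]
  exact fun h => (Finset.mem_Ioi.1 hj).ne' (MvPolynomial.X_injective h)

/-- The product of the differences of the variables with positions in the same block. -/
def blockVandermonde (w : Fin n → Fin N) : MvPolynomial (Fin n) ℂ :=
  ∏ p : Fin n × Fin n with p.1 < p.2 ∧ w p.1 = w p.2, (MvPolynomial.X p.2 - MvPolynomial.X p.1)

/-- For monotone `w` and `a < b`, the factor `z_b - z_a` of `D` lies in exactly one of the two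
products with the same orientation; for other `w` signs would appear. -/
theorem blockR_mul_blockVandermonde {w : Fin n → Fin N} (hw : Monotone w) :
    blockR w * blockVandermonde w = discD n := by
  rw [blockR_eq_prod, ← Fintype.prod_prod_type', blockVandermonde, Finset.prod_filter,
    discD_eq_prod, ← Finset.prod_mul_distrib]
  refine Finset.prod_congr rfl fun p _ => ?_
  rcases lt_or_ge p.1 p.2 with h | h
  · rcases (hw h.le).lt_or_eq with h2 | h2
    · simp [h, h2, h2.ne]
    · simp [h, h2]
  · simp [h.not_gt, (hw h).not_gt]

theorem sign_smul_sign_smul (σ : Equiv.Perm (Fin n)) (p : MvPolynomial (Fin n) ℂ) :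
    ((Equiv.Perm.sign σ : ℤˣ) : ℤ) • ((Equiv.Perm.sign σ : ℤˣ) : ℤ) • p = p := by
  rw [smul_smul, ← Units.val_mul, Int.units_mul_self, Units.val_one, one_smul]

theorem blockR_dvd_discD (w : Fin n → Fin N) : blockR w ∣ discD n := by
  have h := (Dvd.intro _ (blockR_mul_blockVandermonde (Tuple.monotone_sort w)))
  have h2 := map_dvd (MvPolynomial.rename (R := ℂ) (Tuple.sort w)) h
  rw [rename_blockR_comp, rename_discD] at h2
  rw [← sign_smul_sign_smul (Tuple.sort w) (discD n)]
  exact dvd_smul_of_dvd _ h2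

/-- The quotient `D / R_I`. -/
def blockQuot (w : Fin n → Fin N) : MvPolynomial (Fin n) ℂ := (blockR_dvd_discD w).choose

theorem blockR_mul_blockQuot (w : Fin n → Fin N) : blockR w * blockQuot w = discD n :=
  (blockR_dvd_discD w).choose_spec.symm

theorem blockR_ne_zero (w : Fin n → Fin N) : blockR w ≠ 0 := fun h =>
  discD_ne_zero n (by rw [← blockR_mul_blockQuot w, h, zero_mul])

theorem blockQuot_ne_zero (w : Fin n → Fin N) : blockQuot w ≠ 0 := fun h =>
  discD_ne_zero n (by rw [← blockR_mul_blockQuot w, h, mul_zero])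

theorem blockQuot_eq {w : Fin n → Fin N} (hw : Monotone w) : blockQuot w = blockVandermonde w :=
  mul_left_cancel₀ (blockR_ne_zero w)
    ((blockR_mul_blockQuot w).trans (blockR_mul_blockVandermonde hw).symm)

/-- `R_I` is equivariant without sign and `D` alternates, so the quotient carries the sign. -/
theorem rename_blockQuot_comp (w : Fin n → Fin N) (σ : Equiv.Perm (Fin n)) :
    MvPolynomial.rename σ (blockQuot (w ∘ σ)) =
      ((Equiv.Perm.sign σ : ℤˣ) : ℤ) • blockQuot w := by
  refine mul_left_cancel₀ (blockR_ne_zero w) ?_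
  rw [mul_smul_comm, blockR_mul_blockQuot, ← rename_discD, ← blockR_mul_blockQuot (w ∘ σ), map_mul,
    rename_blockR_comp]

/-- The substitution of `X a` for `X b`. -/
def identify (a b : Fin n) : MvPolynomial (Fin n) ℂ →ₐ[ℂ] MvPolynomial (Fin n) ℂ :=
  MvPolynomial.aeval fun i => if i = b then MvPolynomial.X a else MvPolynomial.X i

/-- Modulo `X b - X a` the substitution `identify a b` is the identity, so `p` is congruent to its
image. -/
theorem sub_dvd_iff {a b : Fin n} {p : MvPolynomial (Fin n) ℂ} :
    (MvPolynomial.X b - MvPolynomial.X a) ∣ p ↔ identify a b p = 0 := by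
  constructor
  · rintro ⟨q, rfl⟩
    rw [map_mul]
    convert zero_mul _
    by_cases h : a = b <;> simp [identify, h]
  · intro h
    let I : Ideal (MvPolynomial (Fin n) ℂ) :=
      Ideal.span {MvPolynomial.X b - MvPolynomial.X a}
    have h1 : (Ideal.Quotient.mkₐ ℂ I).comp (identify a b) = Ideal.Quotient.mkₐ ℂ I := by
      refine MvPolynomial.algHom_ext fun i => ?_
      rw [AlgHom.comp_apply, identify, MvPolynomial.aeval_X]
      split_ifs with hi
      · subst hi
        refine ((Ideal.Quotient.mk_eq_mk_iff_sub_mem _ _).2 ?_).symm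
        exact Ideal.subset_span rfl
      · rfl
    have h2 := DFunLike.congr_fun h1 p
    rw [AlgHom.comp_apply, h, map_zero] at h2
    exact Ideal.mem_span_singleton.1 (Ideal.Quotient.eq_zero_iff_mem.1 h2.symm)

/-- The ideal it generates is the kernel of an endomorphism of a domain. -/
theorem prime_sub {a b : Fin n} (hab : a ≠ b) :
    Prime (MvPolynomial.X b - MvPolynomial.X a : MvPolynomial (Fin n) ℂ) := by
  refine ⟨sub_ne_zero.2 fun h => hab (MvPolynomial.X_injective h).symm, fun h => ?_,
    fun p q hpq => ?_⟩
  · have h1 := h.map (identify a b)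
    rw [sub_dvd_iff.1 dvd_rfl] at h1
    exact not_isUnit_zero h1
  · rw [sub_dvd_iff, map_mul, mul_eq_zero] at hpq
    exact hpq.imp sub_dvd_iff.2 sub_dvd_iff.2

/-- Identifying `X a` with `X b` kills `X d - X c` only for the same unordered pair; the orderings
exclude the reversed one. -/
theorem isRelPrime_sub {a b c d : Fin n} (hab : a < b) (hcd : c < d) (h : (a, b) ≠ (c, d)) :
    IsRelPrime (MvPolynomial.X b - MvPolynomial.X a : MvPolynomial (Fin n) ℂ)
      (MvPolynomial.X d - MvPolynomial.X c) := by
  rw [(prime_sub hab.ne).irreducible.isRelPrime_iff_not_dvd, sub_dvd_iff, map_sub, identify,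
    MvPolynomial.aeval_X, MvPolynomial.aeval_X, sub_eq_zero]
  intro h0
  split_ifs at h0 with h1 h2 h2
  · exact hcd.ne (h2.trans h1.symm)
  · exact h (Prod.ext (MvPolynomial.X_injective h0) h1.symm)
  · have := MvPolynomial.X_injective h0
    subst h2 this
    exact absurd (hab.trans hcd) (lt_irrefl _)
  · exact hcd.ne (MvPolynomial.X_injective h0).symm

/-- Once the two variables are identified the swap is invisible, so the image of `p` equals its own
negative. -/
theorem sub_dvd_of_rename_swap {a b : Fin n} {p : MvPolynomial (Fin n) ℂ}
    (hp : MvPolynomial.rename (Equiv.swap a b) p = -p) :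
    (MvPolynomial.X b - MvPolynomial.X a) ∣ p := by
  rw [sub_dvd_iff]
  have h1 : (identify a b).comp (MvPolynomial.rename (Equiv.swap a b)) = identify a b := by
    refine MvPolynomial.algHom_ext fun i => ?_
    rw [AlgHom.comp_apply, MvPolynomial.rename_X, identify, MvPolynomial.aeval_X,
      MvPolynomial.aeval_X]
    by_cases ha : i = a
    · subst ha
      rw [Equiv.swap_apply_left, if_pos rfl]
      split_ifs <;> rfl
    · by_cases hb : i = b
      · subst hb
        rw [Equiv.swap_apply_right, if_pos rfl]
        split_ifs <;> rfl
      · rw [Equiv.swap_apply_of_ne_of_ne ha hb]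
  have h2 := DFunLike.congr_fun h1 p
  rw [AlgHom.comp_apply, hp, map_neg] at h2
  exact self_eq_neg.1 h2.symm

/-- Transpositions inside a block stabilize `w`, so each difference inside a block divides `p`;
these are pairwise coprime. -/
theorem blockVandermonde_dvd {w : Fin n → Fin N} {p : MvPolynomial (Fin n) ℂ}
    (hp : ∀ σ : Equiv.Perm (Fin n), w ∘ σ = w →
      MvPolynomial.rename σ p = ((Equiv.Perm.sign σ : ℤˣ) : ℤ) • p) :
    blockVandermonde w ∣ p := by
  refine Finset.prod_dvd_of_isRelPrime ?_ ?_
  · rintro ⟨a, b⟩ hab ⟨c, d⟩ hcd hne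
    simp only [Finset.coe_filter, Finset.mem_univ, true_and, Set.mem_ofPred_eq] at hab hcd
    exact isRelPrime_sub hab.1 hcd.1 hne
  · rintro ⟨a, b⟩ hab
    simp only [Finset.mem_filter, Finset.mem_univ, true_and] at hab
    refine sub_dvd_of_rename_swap ?_
    rw [hp, Equiv.Perm.sign_swap hab.1.ne]
    · simp
    · funext s
      rw [Function.comp_apply, Equiv.swap_apply_def]
      split_ifs with h1 h2
      · rw [h1, hab.2]
      · rw [h2, hab.2]
      · rfl

open Classical in
/-- The numerator `D i⁻_λ`. -/
def iMinusNum (n : ℕ) (lam : Fin N → ℕ) : EqCohomology n lam →ₗ[ℂ] PolySpace N n :=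
  LinearMap.pi fun w : Fin n → Fin N =>
    if hw : IsIndex lam w then
      LinearMap.mulLeft ℂ (blockQuot w) ∘ₗ (substClass lam w hw).toLinearMap
    else 0

theorem iMinusNum_apply (h : EqCohomology n lam) {w : Fin n → Fin N} (hw : IsIndex lam w) :
    iMinusNum n lam h w = blockQuot w * substClass lam w hw h := by
  simp [iMinusNum, hw]

theorem iMinusNum_apply_of_not (h : EqCohomology n lam) {w : Fin n → Fin N}
    (hw : ¬ IsIndex lam w) : iMinusNum n lam h w = 0 := by
  simp [iMinusNum, hw]

theorem algebraMap_ratFun_ne_zero {p : MvPolynomial (Fin n) ℂ} (hp : p ≠ 0) :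
    algebraMap (MvPolynomial (Fin n) ℂ) (RatFun n) p ≠ 0 :=
  (map_ne_zero_iff _ (IsFractionRing.injective _ _)).2 hp

theorem iMinus_eq (h : EqCohomology n lam) :
    iMinus n lam h = divD N n (iMinusNum n lam h) := by
  funext w
  by_cases hw : IsIndex lam w
  · have h1 : divD N n (iMinusNum n lam h) w = (algebraMap (MvPolynomial (Fin n) ℂ) (RatFun n)
        (discD n))⁻¹ * algebraMap _ (RatFun n) (iMinusNum n lam h w) := rfl
    have h2 : iMinus n lam h w = (algebraMap (MvPolynomial (Fin n) ℂ) (RatFun n)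
        (blockR w))⁻¹ * algebraMap _ (RatFun n) (substClass lam w hw h) := by
      simp [iMinus, hw]
    have hR := algebraMap_ratFun_ne_zero (blockR_ne_zero w)
    have hQ := algebraMap_ratFun_ne_zero (blockQuot_ne_zero w)
    rw [h1, h2, iMinusNum_apply h hw, ← blockR_mul_blockQuot w, map_mul, map_mul]
    field_simp
  · have h1 : iMinus n lam h w = 0 := by simp [iMinus, hw]
    have h2 : divD N n (iMinusNum n lam h) w = (algebraMap (MvPolynomial (Fin n) ℂ) (RatFun n)
        (discD n))⁻¹ * algebraMap _ (RatFun n) (iMinusNum n lam h w) := rfl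
    rw [h1, h2, iMinusNum_apply_of_not h hw, map_zero, mul_zero]

theorem divD_injective (N n : ℕ) : Function.Injective (divD N n) := by
  intro x y hxy
  funext w
  have h : (algebraMap (MvPolynomial (Fin n) ℂ) (RatFun n) (discD n))⁻¹ *
      algebraMap _ (RatFun n) (x w) = (algebraMap (MvPolynomial (Fin n) ℂ) (RatFun n)
        (discD n))⁻¹ * algebraMap _ (RatFun n) (y w) := congrFun hxy w
  exact IsFractionRing.injective _ (RatFun n) (mul_left_cancel₀
    (inv_ne_zero (algebraMap_ratFun_ne_zero (discD_ne_zero n))) h)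

theorem iMinusNum_mem (hlam : ∑ i, lam i = n) (h : EqCohomology n lam) :
    iMinusNum n lam h ∈ VMinus n lam := by
  refine ⟨mem_antiinvariants.2 fun σ w => ?_,
    mem_weightSpace.2 fun w hw => iMinusNum_apply_of_not h hw⟩
  by_cases hw : IsIndex lam w
  · rw [iMinusNum_apply h hw, iMinusNum_apply h (hw.comp σ), map_mul,
      rename_substClass_comp lam hlam, rename_blockQuot_comp, smul_mul_assoc]
  · rw [iMinusNum_apply_of_not h hw, iMinusNum_apply_of_not h (mt (isIndex_comp_iff w σ).1 hw),
      map_zero, smul_zero]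

theorem iMinusNum_injective (hlam : ∑ i, lam i = n) : Function.Injective (iMinusNum n lam) := by
  obtain ⟨w, hw⟩ := exists_isIndex lam hlam
  intro h h' heq
  have := congrFun heq w
  rw [iMinusNum_apply h hw, iMinusNum_apply h' hw] at this
  exact substClass_injective lam hlam w hw (mul_left_cancel₀ (blockQuot_ne_zero w) this)

theorem range_iMinusNum (hlam : ∑ i, lam i = n) :
    LinearMap.range (iMinusNum n lam) = VMinus n lam := by
  refine le_antisymm ?_ ?_
  · rintro _ ⟨h, rfl⟩
    exact iMinusNum_mem hlam h
  · rintro x ⟨hx, hxw⟩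
    -- A sorted index makes `D / R_I` equal to the product of differences inside blocks, with no
    -- sign.
    obtain ⟨w, hw, hmono⟩ : ∃ w : Fin n → Fin N, IsIndex lam w ∧ Monotone w := by
      obtain ⟨w, hw⟩ := exists_isIndex lam hlam
      exact ⟨_, hw.comp (Tuple.sort w), Tuple.monotone_sort w⟩
    rw [SetLike.mem_coe, mem_antiinvariants] at hx
    have hstab : ∀ σ : Equiv.Perm (Fin n), w ∘ σ = w →
        MvPolynomial.rename σ (x w) = ((Equiv.Perm.sign σ : ℤˣ) : ℤ) • x w := fun σ hσ => by
      conv_lhs => rw [← hσ, hx σ w]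
    obtain ⟨y, hy⟩ := blockVandermonde_dvd hstab
    rw [← blockQuot_eq hmono] at hy
    -- Both `x w` and `D / R_I` change by the sign of `σ`, so their quotient `y` is invariant under
    -- the stabilizer.
    obtain ⟨h, hh⟩ := exists_substClass_eq lam w hw y fun σ hσ => by
      have h1 := hstab σ hσ
      have h2 := rename_blockQuot_comp w σ
      rw [hσ] at h2
      rw [hy, map_mul, h2, smul_mul_assoc] at h1
      have h3 := congrArg (fun p => ((Equiv.Perm.sign σ : ℤˣ) : ℤ) • p) h1
      simp only [sign_smul_sign_smul] at h3
      exact mul_left_cancel₀ (blockQuot_ne_zero w) h3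
    refine ⟨h, funext fun w' => ?_⟩
    by_cases hw' : IsIndex lam w'
    · obtain ⟨σ, rfl⟩ := exists_comp_eq hw' hw
      have h1 := mem_antiinvariants.1 (iMinusNum_mem hlam h).1 σ w'
      rw [iMinusNum_apply h hw, hh, ← hy, hx σ w'] at h1
      have h3 := congrArg (fun p => ((Equiv.Perm.sign σ : ℤˣ) : ℤ) • p) h1
      simp only [sign_smul_sign_smul] at h3
      exact h3.symm
    · rw [iMinusNum_apply_of_not h hw', mem_weightSpace.1 hxw w' hw']

end

end FlagBethe
end
open FlagBethe
theorem theorem3p3 (N n : ℕ) (lam : Fin N → ℕ) (hlam : ∑ i, lam i = n) :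
    -- the two weight subspaces are invariant under the limiting Bethe algebra
    (∀ b ∈ betheInf N, ∀ x ∈ VPlus n lam, uAction N n b x ∈ VPlus n lam) ∧
    (∀ b ∈ betheInf N, ∀ x ∈ VMinus n lam, uAction N n b x ∈ VMinus n lam) ∧
    -- plus sign: the assignment defines a unique homomorphism, which is an isomorphism,
    -- and it is compatible with the bijection `i⁺` onto `V⁺_λ`
    (∃ ξ : betheInfOn (VPlus n lam) ≃ₐ[ℂ] EqCohomology n lam,
      (∀ (i : Fin N) (r : ℕ), ∃ b : betheInfOn (VPlus n lam),
        ActsAs b.1 (uBasis i i r) ∧ ξ b = powerSumClass n lam i r) ∧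
      (∀ ξ' : betheInfOn (VPlus n lam) →ₐ[ℂ] EqCohomology n lam,
        (∀ (i : Fin N) (r : ℕ) (b : betheInfOn (VPlus n lam)),
          ActsAs b.1 (uBasis i i r) → ξ' b = powerSumClass n lam i r) →
        ξ' = (ξ : betheInfOn (VPlus n lam) →ₐ[ℂ] EqCohomology n lam)) ∧
      Function.Injective (iPlus n lam) ∧
      LinearMap.range (iPlus n lam) = VPlus n lam ∧
      (∀ (b : betheInfOn (VPlus n lam)) (h : EqCohomology n lam) (x : VPlus n lam),
        iPlus n lam h = x → iPlus n lam (ξ b * h) = (b.1 x : VPlus n lam))) ∧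
    -- minus sign: the same with the bijection `i⁻` onto `(1/D) V⁻_λ`
    (∃ ξ : betheInfOn (VMinus n lam) ≃ₐ[ℂ] EqCohomology n lam,
      (∀ (i : Fin N) (r : ℕ), ∃ b : betheInfOn (VMinus n lam),
        ActsAs b.1 (uBasis i i r) ∧ ξ b = powerSumClass n lam i r) ∧
      (∀ ξ' : betheInfOn (VMinus n lam) →ₐ[ℂ] EqCohomology n lam,
        (∀ (i : Fin N) (r : ℕ) (b : betheInfOn (VMinus n lam)),
          ActsAs b.1 (uBasis i i r) → ξ' b = powerSumClass n lam i r) →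
        ξ' = (ξ : betheInfOn (VMinus n lam) →ₐ[ℂ] EqCohomology n lam)) ∧
      Function.Injective (iMinus n lam) ∧
      LinearMap.range (iMinus n lam) = (VMinus n lam).map (divD N n) ∧
      (∀ (b : betheInfOn (VMinus n lam)) (h : EqCohomology n lam) (x : VMinus n lam),
        iMinus n lam h = divD N n x →
          iMinus n lam (ξ b * h) = divD N n (b.1 x : VMinus n lam))) := by
  let ePlus : EqCohomology n lam ≃ₗ[ℂ] VPlus n lam :=
    (LinearEquiv.ofInjective (iPlus n lam) (iPlus_injective hlam)).trans
      (LinearEquiv.ofEq _ _ (range_iPlus hlam))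
  -- The regular representation is set up on polynomial numerators; the factor `1 / D` is restored
  -- at the end through the injective map `divD`.
  let eMinus : EqCohomology n lam ≃ₗ[ℂ] VMinus n lam :=
    (LinearEquiv.ofInjective (iMinusNum n lam) (iMinusNum_injective hlam)).trans
      (LinearEquiv.ofEq _ _ (range_iMinusNum hlam))
  have hePlus : ∀ h, (ePlus h : PolySpace N n) = iPlus n lam h := fun _ => rfl
  have heMinus : ∀ h, (eMinus h : PolySpace N n) = iMinusNum n lam h := fun _ => rfl
  obtain ⟨hP, ξP, hP1, hP2, hP3⟩ := exists_betheInfOn_equiv hlam (VPlus n lam) ePlus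
    fun i r h => by
      funext w
      rw [uAction_uBasis_diag, hePlus, hePlus]
      by_cases hw : IsIndex lam w
      · rw [iPlus_apply _ hw, iPlus_apply _ hw, map_mul, substClass_powerSumClass]
      · rw [iPlus_apply_of_not _ hw, iPlus_apply_of_not _ hw, mul_zero]
  obtain ⟨hM, ξM, hM1, hM2, hM3⟩ := exists_betheInfOn_equiv hlam (VMinus n lam) eMinus
    fun i r h => by
      funext w
      rw [uAction_uBasis_diag, heMinus, heMinus]
      by_cases hw : IsIndex lam w
      · rw [iMinusNum_apply _ hw, iMinusNum_apply _ hw, map_mul, substClass_powerSumClass,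
          mul_left_comm]
      · rw [iMinusNum_apply_of_not _ hw, iMinusNum_apply_of_not _ hw, mul_zero]
  have hcomp : iMinus n lam = divD N n ∘ₗ iMinusNum n lam := LinearMap.ext iMinus_eq
  refine ⟨hP, hM, ⟨ξP, hP1, hP2, iPlus_injective hlam, range_iPlus hlam, fun b h x hx => ?_⟩,
    ⟨ξM, hM1, hM2, ?_, ?_, fun b h x hx => ?_⟩⟩
  · obtain rfl : ePlus h = x := Subtype.ext hx
    rw [← hP3, hePlus]
  · rw [hcomp]
    exact (divD_injective N n).comp (iMinusNum_injective hlam)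
  · rw [hcomp, LinearMap.range_comp, range_iMinusNum hlam]
  · rw [iMinus_eq] at hx
    obtain rfl : eMinus h = x := Subtype.ext (divD_injective N n hx)
    rw [← hM3, iMinus_eq, heMinus]
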